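/- **Setting.** Let $m,n\ge 1$, let $q_1,\dots,q_m\in\Delta_n$ (the probability simplex in $\mathbb R^n$), let $C\in\mathbb R_+^{n\times n}$, $C\neq 0$, let $d\in\mathbb R^{n^2}$ be its vectorization, so $\|d\|_\infty=\|C\|_\infty=\max_{a,b}C_{ab}$, and let $\varepsilon>0$. Let $A\in\{0,1\}^{2n\times n^2}$ be the incidence matrix ($Ax$ lists the row sums and then the column sums of the $n\times n$ matrix $x$). Put $\mathcal X=(\Delta_{n^2})^m\times\Delta_n$ with elements $\mathbf x=(x_1,\dots,x_m,p)$, $\mathcal Y=([-1,1]^{2n})^m$ with elements $\mathbf y=(y_1,\dots,y_m)$, $\boldsymbol d=(d,\dots,d,0_n)$, $\boldsymbol c=(0_n,q_1,\dots,0_n,q_m)$, $\boldsymbol A\mathbf x=(Ax_i-(p,0_n))_{i=1}^m$ and $$F(\mathbf x,\mathbf y)=\tfrac1m\bigl\{\boldsymbol d^\top\mathbf x+2\|d\|_\infty(\mathbf y^\top\boldsymbol A\mathbf x-\boldsymbol c^\top\mathbf y)\bigr\}.$$ The Wasserstein barycenter problem is $\min_{\mathbf x\in\mathcal X}\max_{\mathbf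 y\in\mathcal Y}F(\mathbf x,\mathbf y)$. **Alternating minimization** $\mathtt{AM}(M,\mathbf v,\mathbf u)$, for $\mathbf v=(v_1,\dots,v_m,v_{m+1})$ and $\mathbf u=(u_1,\dots,u_m)$. Start from $x_i=\frac1{n^2}\mathbf 1$, $p=\frac1n\mathbf 1$, $y_i=0$; repeat $M$ times, with squares, quotients and exponentials taken entrywise: * $x_i\leftarrow e^{-\gamma_i}/\sum_j[e^{-\gamma_i}]_j$ with $\gamma_i=\frac{m}{20\|d\|_\infty}v_i+\frac1{10}A^\top (y_i)^2$, for $i\le m$; * $p\leftarrow e^{-\gamma_{m+1}}/\sum_j[e^{-\gamma_{m+1}}]_j$ with $\gamma_{m+1}=\frac{1}{10\|d\|_\infty}v_{m+1}+\frac1{5m}\sum_{j=1}^m[(y_j)^2]_{1,\dots,n}$; * with the new $x_i$ and $p$, $y_i\leftarrow$ the projection onto $[-1,1]^{2n}$ of $-\frac{m}{4\|d\|_\infty}\,u_i/(Ax_i+(p,0_n))$, for $i\le m$. Return $(\mathbf x,\mathbf y)$. These are the exact alternating minimization steps over $\mathcal X\times\mathcal Y$ for $\langle\mathbf v,\mathbf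 x\rangle+\langle\mathbf u,\mathbf y\rangle+r(\mathbf x,\mathbf y)$ with $$r(\mathbf x,\mathbf y)=\tfrac{2\|d\|_\infty}{m}\Bigl(10\sum_i\langle x_i,\log x_i\rangle+5m\langle p,\log p\rangle+\sum_i\langle Ax_i+(p,0_n),(y_i)^2\rangle\Bigr).$$ **Dual extrapolation.** Let $\kappa=3$, $\Theta=40\|d\|_\infty\log n+6\|d\|_\infty$ and $$M=\max\Bigl\{0,\Bigl\lceil 24\log\Bigl(\Bigl(\tfrac{88\|d\|_\infty}{\varepsilon^2}+\tfrac4\varepsilon\Bigr)\Theta+\tfrac{36\|d\|_\infty}{\varepsilon}\Bigr)\Bigr\rceil\Bigr\}.$$ Let $\rho_{\mathbf x}=\frac{10\|d\|_\infty}{m}\bigl((-4\log n+2)\mathbf 1_{mn^2},\,m(-\log n+1)\mathbf 1_n\bigr)$ and $\rho_{\mathbf y}=0$ (the gradient of $r$ at its minimizer over $\mathcal X\times\mathcal Y$). Start from $\mathbf s^0=0$; for $k=0,\dots,N-1$ do: * $\mathbf v=\mathbf s^k_{\mathbf x}-\rho_{\mathbf x}$, $\ \mathbf u=\mathbf s^k_{\mathbf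 y}-\rho_{\mathbf y}$, $\ (\mathbf z_{\mathbf x},\mathbf z_{\mathbf y})=\mathtt{AM}(M,\mathbf v,\mathbf u)$; * $\mathbf v\leftarrow\mathbf v+\frac1{\kappa m}(\boldsymbol d+2\|d\|_\infty\boldsymbol A^\top\mathbf z_{\mathbf y})$, $\ \mathbf u\leftarrow\mathbf u+\frac{2\|d\|_\infty}{\kappa m}(\boldsymbol c-\boldsymbol A\mathbf z_{\mathbf x})$, $\ (\mathbf w^k_{\mathbf x},\mathbf w^k_{\mathbf y})=\mathtt{AM}(M,\mathbf v,\mathbf u)$; * $\mathbf s^{k+1}_{\mathbf x}=\mathbf s^k_{\mathbf x}+\frac1{2\kappa m}(\boldsymbol d+2\|d\|_\infty\boldsymbol A^\top\mathbf w^k_{\mathbf y})$, $\ \mathbf s^{k+1}_{\mathbf y}=\mathbf s^k_{\mathbf y}+\frac{\|d\|_\infty}{\kappa m}(\boldsymbol c-\boldsymbol A\mathbf w^k_{\mathbf x})$. Output $\widetilde{\mathbf w}_{\mathbf x}=\frac1N\sum_{k<N}\mathbf w^k_{\mathbf x}$ and $\widetilde{\mathbf w}_{\mathbf y}=\frac1N\sum_{k<N}\mathbf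 w^k_{\mathbf y}$. **Theorem.** Run dual extrapolation for $$N=\Bigl\lceil\frac{12\Theta}{\varepsilon}\Bigr\rceil=\Bigl\lceil\frac{480\log n\,\|d\|_\infty+72\|d\|_\infty}{\varepsilon}\Bigr\rceil$$ iterations. Then $(\widetilde{\mathbf w}_{\mathbf x},\widetilde{\mathbf w}_{\mathbf y})\in\mathcal X\times\mathcal Y$ and its duality gap satisfies $$\max_{\mathbf y\in\mathcal Y}F(\widetilde{\mathbf w}_{\mathbf x},\mathbf y)-\min_{\mathbf x\in\mathcal X}F(\mathbf x,\widetilde{\mathbf w}_{\mathbf y})\le\varepsilon .$$ The running time is $\widetilde O(mn^2\|d\|_\infty/\varepsilon)=\widetilde O(mn^2\|C\|_\infty/\varepsilon)$ in the following sense. Count as one unit each arithmetic operation, exponential, logarithm, maximum, minimum or absolute value of real numbers, each read or write of one number, and each loop iteration; $\lceil\cdot\rceil$ is computed by counting upwards, and $A$, $A^\top$ are applied using only their nonzero entries. There is an absolute constant $K$ such that, whenever $\Gamma:=\frac{\|d\|_\infty}{\varepsilon}(1+\log n)\ge 1$, the total number of units is at most $$K\,\frac{mn^2\|d\|_\infty}{\varepsilon}\,(1+\log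 n)\,(1+\log\Gamma).$$ -/

import Mathlib

/-!
Wasserstein barycenters of `m` histograms of size `n` as a bilinear saddle-point problem, and the
dual extrapolation algorithm for it, written in a monad that counts elementary operations.

Conventions: a transport plan is a vector indexed by `Fin n × Fin n` (row, column); `[-1,1]^{2n}`
is indexed by `Fin n ⊕ Fin n` (the first `n` and the last `n` coordinates).
-/

namespace WB

noncomputable section

/-! ### The saddle-point problem -/

/-- Vectors `(x₁, …, x_m, p) ∈ ℝ^{m n² + n}`. -/
abbrev Primal (m n : ℕ) : Type := (Fin m → Fin n × Fin n → ℝ) × (Fin n → ℝ)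

/-- Vectors `(y₁, …, y_m) ∈ ℝ^{2 m n}`. -/
abbrev Dual (m n : ℕ) : Type := Fin m → Fin n ⊕ Fin n → ℝ

/-- `𝒳 = Δ_{n²} × ⋯ × Δ_{n²} × Δ_n`. -/
def primalSet (m n : ℕ) : Set (Primal m n) :=
  {z | (∀ i, z.1 i ∈ stdSimplex ℝ (Fin n × Fin n)) ∧ z.2 ∈ stdSimplex ℝ (Fin n)}

/-- `𝒴 = [-1,1]^{2mn}`. -/
def dualSet (m n : ℕ) : Set (Dual m n) :=
  {y | ∀ i j, y i j ∈ Set.Icc (-1 : ℝ) 1}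

/-- The vectorized cost matrix `d`. -/
def costVec {n : ℕ} (C : Matrix (Fin n) (Fin n) ℝ) : Fin n × Fin n → ℝ := fun e => C e.1 e.2

/-- `‖d‖_∞ = ‖C‖_∞ = max_{a,b} |C_{ab}|` (the norm of a function type is the sup norm). -/
def costNorm {n : ℕ} (C : Matrix (Fin n) (Fin n) ℝ) : ℝ := ‖costVec C‖

/-- The incidence matrix `A ∈ {0,1}^{2n × n²}`: for a plan `x`, `A x` is the pair of the row sums
and the column sums of `x`. -/
def incidence (n : ℕ) : Matrix (Fin n ⊕ Fin n) (Fin n × Fin n) ℝ :=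
  Matrix.of fun r e => Sum.elim (fun a => if e.1 = a then 1 else 0)
    (fun b => if e.2 = b then 1 else 0) r

/-- The big matrix `𝑨 = (Â ℰ)` applied to `(x₁, …, x_m, p)`: its `i`-th block is
`A xᵢ - (p, 0)`. -/
def bigA {m n : ℕ} (z : Primal m n) : Dual m n :=
  fun i => (incidence n).mulVec (z.1 i) - Sum.elim z.2 0

/-- The vector `𝒄 = (0, q₁, …, 0, q_m)`. -/
def bigC {m n : ℕ} (q : Fin m → Fin n → ℝ) : Dual m n := fun i => Sum.elim 0 (q i)

/-- The objective `F(𝐱, 𝐲) = (1/m) { 𝒅ᵀ𝐱 + 2‖d‖_∞ (𝐲ᵀ𝑨𝐱 - 𝒄ᵀ𝐲) }`. -/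
def saddleF {m n : ℕ} (C : Matrix (Fin n) (Fin n) ℝ) (q : Fin m → Fin n → ℝ)
    (z : Primal m n) (y : Dual m n) : ℝ :=
  (1 / (m : ℝ)) * ((∑ i, costVec C ⬝ᵥ z.1 i) +
    2 * costNorm C * ((∑ i, y i ⬝ᵥ bigA z i) - ∑ i, bigC q i ⬝ᵥ y i))

/-- `max_{𝐲 ∈ 𝒴} F(z, 𝐲) - min_{𝐱 ∈ 𝒳} F(𝐱, y) ≤ ε`, the maximum and the minimum being
attained. -/
def DualityGapLE {m n : ℕ} (C : Matrix (Fin n) (Fin n) ℝ) (q : Fin m → Fin n → ℝ)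
    (z : Primal m n) (y : Dual m n) (ε : ℝ) : Prop :=
  ∃ a b : ℝ, IsGreatest ((fun y' => saddleF C q z y') '' dualSet m n) a ∧
    IsLeast ((fun z' => saddleF C q z' y) '' primalSet m n) b ∧ a - b ≤ ε

/-! ### Counting elementary operations

Real random access machine: reading or writing one number, one arithmetic operation, one `exp`,
`log`, `max`, `min` or absolute value, and the bookkeeping of one loop iteration cost one unit
each. Real numbers are only ever produced by the operations below. -/

/-- The result of a computation together with the number of elementary operations it took. -/
structure Timed (α : Type) where
  val : α
  cost : ℕ

namespace Timed

instance : Monad Timed where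
  pure a := ⟨a, 0⟩
  bind t f := ⟨(f t.val).val, t.cost + (f t.val).cost⟩

/-- Read a number (a variable, an input, or a constant). -/
def rd (r : ℝ) : Timed ℝ := ⟨r, 1⟩

instance : Add (Timed ℝ) := ⟨fun s t => ⟨s.val + t.val, s.cost + t.cost + 1⟩⟩
instance : Sub (Timed ℝ) := ⟨fun s t => ⟨s.val - t.val, s.cost + t.cost + 1⟩⟩
instance : Mul (Timed ℝ) := ⟨fun s t => ⟨s.val * t.val, s.cost + t.cost + 1⟩⟩
instance : Div (Timed ℝ) := ⟨fun s t => ⟨s.val / t.val, s.cost + t.cost + 1⟩⟩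
instance : Neg (Timed ℝ) := ⟨fun t => ⟨-t.val, t.cost + 1⟩⟩

def exp (t : Timed ℝ) : Timed ℝ := ⟨Real.exp t.val, t.cost + 1⟩
def log (t : Timed ℝ) : Timed ℝ := ⟨Real.log t.val, t.cost + 1⟩

/-- Projection onto `[-1,1]`: one `min` and one `max`. -/
def clip (t : Timed ℝ) : Timed ℝ := ⟨max (-1) (min 1 t.val), t.cost + 2⟩

/-- Rounding up to a natural number (`0` for nonpositive arguments), by counting upwards. -/
def ceil (t : Timed ℝ) : Timed ℕ := ⟨⌈t.val⌉₊, t.cost + ⌈t.val⌉₊ + 1⟩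

/-- Compute all entries of a vector one after the other and write them. -/
def vec {ι : Type} [Fintype ι] {α : Type} (f : ι → Timed α) : Timed (ι → α) :=
  ⟨fun i => (f i).val, ∑ i, ((f i).cost + 1)⟩

/-- Sum of a vector: one read and one addition for each entry. -/
def total {ι : Type} [Fintype ι] (f : ι → ℝ) : Timed ℝ := ⟨∑ i, f i, 2 * Fintype.card ι⟩

/-- Largest absolute value of an entry: one read, one absolute value, one `max` for each entry. -/
def maxAbs {ι : Type} [Fintype ι] (f : ι → ℝ) : Timed ℝ := ⟨‖f‖, 3 * Fintype.card ι⟩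

/-- Repeat `f` for `N` iterations. -/
def iter {α : Type} (f : α → Timed α) : ℕ → α → Timed α
  | 0, a => ⟨a, 0⟩
  | k + 1, a =>
    let t := iter f k a
    ⟨(f t.val).val, t.cost + (f t.val).cost + 1⟩

end Timed

open Timed

/-! ### Linear algebra -/

/-- `A x`: row sums and column sums. -/
def mulA {n : ℕ} (x : Fin n × Fin n → ℝ) : Timed (Fin n ⊕ Fin n → ℝ) :=
  vec (Sum.elim (fun a => total fun b => x (a, b)) (fun b => total fun a => x (a, b)))

/-- `Aᵀ y`: two nonzero terms for each coordinate. -/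
def mulAT {n : ℕ} (y : Fin n ⊕ Fin n → ℝ) : Timed (Fin n × Fin n → ℝ) :=
  vec fun e => rd (y (Sum.inl e.1)) + rd (y (Sum.inr e.2))

/-- `𝒅 + 2 D 𝑨ᵀ 𝐲`, which is `m ∇_𝐱 F` for `D = ‖d‖_∞`. -/
def gradX {m n : ℕ} (d : Fin n × Fin n → ℝ) (D : ℝ) (y : Dual m n) : Timed (Primal m n) := do
  let gx ← vec fun i => do
    let t ← mulAT (y i)
    vec fun e => rd (d e) + rd 2 * rd D * rd (t e)
  let gp ← vec fun a => do
    let t ← total fun i => y i (Sum.inl a)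
    rd 2 * rd D * -rd t
  pure (gx, gp)

/-- `𝒄 - 𝑨 𝐱`, which is `-(m / (2‖d‖_∞)) ∇_𝐲 F`. -/
def gradY {m n : ℕ} (q : Fin m → Fin n → ℝ) (z : Primal m n) : Timed (Dual m n) :=
  vec fun i => do
    let t ← mulA (z.1 i)
    vec (Sum.elim (fun a => rd 0 - (rd (t (Sum.inl a)) - rd (z.2 a)))
      (fun b => rd (q i b) - rd (t (Sum.inr b))))

/-- `v + c • w` in `ℝ^{m n² + n}`. -/
def axpyP {m n : ℕ} (c : ℝ) (w v : Primal m n) : Timed (Primal m n) := do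
  let x ← vec fun i => vec fun e => rd (v.1 i e) + rd c * rd (w.1 i e)
  let p ← vec fun a => rd (v.2 a) + rd c * rd (w.2 a)
  pure (x, p)

/-- `v + c • w` in `ℝ^{2 m n}`. -/
def axpyD {m n : ℕ} (c : ℝ) (w v : Dual m n) : Timed (Dual m n) :=
  vec fun i => vec fun j => rd (v i j) + rd c * rd (w i j)

/-- `exp(-g) / ∑ⱼ [exp(-g)]ⱼ`. -/
def softmin {ι : Type} [Fintype ι] (g : ι → ℝ) : Timed (ι → ℝ) := do
  let e ← vec fun j => Timed.exp (-rd (g j))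
  let s ← total e
  vec fun j => rd (e j) / rd s

/-! ### Alternating minimization -/

/-- One iteration of alternating minimization for `⟨v, 𝐱⟩ + ⟨u, 𝐲⟩ + r(𝐱, 𝐲)` over `𝒳 × 𝒴`, where
`D = ‖d‖_∞` and `r` is the area-convex regularizer. -/
def amStep {m n : ℕ} (D : ℝ) (v : Primal m n) (u : Dual m n) (z : Primal m n × Dual m n) :
    Timed (Primal m n × Dual m n) := do
  let x ← vec fun i => do
    let sq ← vec fun j => rd (z.2 i j) * rd (z.2 i j)
    let t ← mulAT sq
    let g ← vec fun e => rd m / (rd 20 * rd D) * rd (v.1 i e) + rd 1 / rd 10 * rd (t e)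
    softmin g
  let g ← vec fun a => do
    let sq ← vec fun i => rd (z.2 i (Sum.inl a)) * rd (z.2 i (Sum.inl a))
    let t ← total sq
    rd 1 / (rd 10 * rd D) * rd (v.2 a) + rd 1 / (rd 5 * rd m) * rd t
  let p ← softmin g
  let y ← vec fun i => do
    let t ← mulA (x i)
    vec (Sum.elim
      (fun a => clip (-(rd m / (rd 4 * rd D)) *
        (rd (u i (Sum.inl a)) / (rd (t (Sum.inl a)) + rd (p a)))))
      (fun b => clip (-(rd m / (rd 4 * rd D)) *
        (rd (u i (Sum.inr b)) / rd (t (Sum.inr b))))))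
  pure ((x, p), y)

/-- `AM(M, v, u)`: `M` iterations from the uniform distributions and `𝐲 = 0`. -/
def altMin {m n : ℕ} (D : ℝ) (M : ℕ) (v : Primal m n) (u : Dual m n) :
    Timed (Primal m n × Dual m n) := do
  let x ← vec fun _ => vec fun _ => rd 1 / (rd n * rd n)
  let p ← vec fun _ => rd 1 / rd n
  let y ← vec fun _ => vec fun _ => rd 0
  iter (amStep D v u) M ((x, p), y)

/-! ### Dual extrapolation -/

/-- The values that do not change during the main loop. -/
structure Params (m n : ℕ) where
  /-- the vectorized cost matrix -/
  d : Fin n × Fin n → ℝ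
  /-- `‖d‖_∞` -/
  D : ℝ
  /-- number of alternating minimization steps -/
  M : ℕ
  /-- `∇_𝐱 r` at the minimizer of `r` -/
  rx : Primal m n
  /-- `∇_𝐲 r` at the minimizer of `r` -/
  ry : Dual m n

/-- `Θ = 40 ‖d‖_∞ log n + 6 ‖d‖_∞`. -/
def Theta {n : ℕ} (C : Matrix (Fin n) (Fin n) ℝ) : ℝ :=
  40 * costNorm C * Real.log n + 6 * costNorm C

/-- Computation of the parameters: `‖d‖_∞`, `Θ`,
`M = ⌈24 log((88‖d‖_∞/ε² + 4/ε) Θ + 36‖d‖_∞/ε)⌉`, and the gradient of `r` at its minimizer. -/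
def initParams {n : ℕ} (m : ℕ) (C : Matrix (Fin n) (Fin n) ℝ) (ε : ℝ) :
    Timed (Params m n) := do
  let d ← vec fun e : Fin n × Fin n => rd (C e.1 e.2)
  let D ← maxAbs d
  let T ← rd 40 * rd D * Timed.log (rd n) + rd 6 * rd D
  let M ← ceil (rd 24 * Timed.log
    ((rd 88 * rd D / (rd ε * rd ε) + rd 4 / rd ε) * rd T + rd 36 * rd D / rd ε))
  let rx ← vec fun _ => vec fun _ =>
    rd 10 * rd D / rd m * (-rd 4 * Timed.log (rd n) + rd 2)
  let rp ← vec fun _ => rd 10 * rd D / rd m * (rd m * (-Timed.log (rd n) + rd 1))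
  let ry ← vec fun _ => vec fun _ => rd 0
  pure ⟨d, D, M, (rx, rp), ry⟩

/-- The state of the main loop: the dual iterate `𝐬ᵏ` and the running sum of the `𝐰ʲ`, `j < k`. -/
structure State (m n : ℕ) where
  sx : Primal m n
  sy : Dual m n
  sumX : Primal m n
  sumY : Dual m n

/-- One iteration of dual extrapolation, with area-convexity coefficient `κ = 3`. -/
def deStep {m n : ℕ} (q : Fin m → Fin n → ℝ) (P : Params m n) (S : State m n) :
    Timed (State m n) := do
  let v ← axpyP (-1) P.rx S.sx
  let u ← axpyD (-1) P.ry S.sy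
  let z ← altMin P.D P.M v u
  let c₁ ← rd 1 / (rd 3 * rd m)
  let gx ← gradX P.d P.D z.2
  let v' ← axpyP c₁ gx v
  let c₂ ← rd 2 * rd P.D / (rd 3 * rd m)
  let gy ← gradY q z.1
  let u' ← axpyD c₂ gy u
  let w ← altMin P.D P.M v' u'
  let c₃ ← rd 1 / (rd 2 * rd 3 * rd m)
  let hx ← gradX P.d P.D w.2
  let sx ← axpyP c₃ hx S.sx
  let c₄ ← rd P.D / (rd 3 * rd m)
  let hy ← gradY q w.1
  let sy ← axpyD c₄ hy S.sy
  let sumX ← axpyP 1 w.1 S.sumX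
  let sumY ← axpyD 1 w.2 S.sumY
  pure ⟨sx, sy, sumX, sumY⟩

/-- Dual extrapolation for Wasserstein barycenters with `N` iterations: input `C`, `q`, `ε`;
output `(1/N) ∑_{k<N} 𝐰ᵏ`. -/
def dualExtrapolation {m n : ℕ} (C : Matrix (Fin n) (Fin n) ℝ) (q : Fin m → Fin n → ℝ)
    (ε : ℝ) (N : ℕ) : Timed (Primal m n × Dual m n) := do
  let P ← initParams m C ε
  let x₀ ← vec fun _ => vec fun _ => rd 0
  let p₀ ← vec fun _ => rd 0
  let y₀ ← vec fun _ => vec fun _ => rd 0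
  let S ← iter (deStep q P) N ⟨(x₀, p₀), y₀, (x₀, p₀), y₀⟩
  let c ← rd 1 / rd N
  let wx ← axpyP c S.sumX (x₀, p₀)
  let wy ← axpyD c S.sumY y₀
  pure (wx, wy)

end

end WB

namespace WB

noncomputable section

open Timed

/-! ### Scalar inequalities -/

/-! The regularizer is a sum, over the nonzero entries of `𝑨`, of the two-variable function `5 x log
x + x y²`. Each plan entry occurs twice and each entry of `p` occurs `m` times, and `𝐲ᵀ𝑨𝐱` is a
signed sum of `x y` over the same cells. Convexity questions thus become scalar inequalities, proved
with quadratic lower bounds for the divergence `entDiv`.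

Two such inequalities carry the proof. First, `2 x log x + x y²` is already jointly convex
(`le_two_mul_entDiv`). Both half-steps of alternating minimization are exact, and only two of the
five units of entropy are needed to absorb the coupling, so the divergence from the optimum shrinks
by the factor `2/5` per round (`amSeq_converges`). Its first value is at most `6 D`, whatever the
linear terms, so logarithmically many rounds suffice. Second, `5 x log x + x y²` is area convex with
coefficient 3 (`area_le_cellReg`, summed in `reg_area_convex`).

For the outer loop, the potential is the minimum of linear form plus regularizer. Area convexity at
the two proximal points and an arbitrary comparison point shows that an iteration raises this
minimum by at least one sixth of the gradient paired with `𝐰`, up to the inner error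
(`dual_extrapolation_step`). Telescoping between the bounds `-50 D log n ≤ r ≤ 6 D` gives the regret
bound `deSeq_regret`. As the objective is affine in each argument, regret divided by `N` is the
duality gap of the averages.

The operation count is compositional: one alternating step costs `O(m n²)`, and `N` and `M` are
bounded in terms of `Γ`. -/

/-- The Bregman divergence of `s ↦ s log s`. -/
def entDiv (s t : ℝ) : ℝ := s * Real.log s - s * Real.log t - s + t

/-- This is `log (1 + x) ≥ 2x / (x + 2)` at `x = (s - t)/t`, multiplied by `s`. -/
theorem entDiv_ge_of_le {s t : ℝ} (ht : 0 < t) (h : t ≤ s) :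
    (s - t) ^ 2 / (s + t) ≤ entDiv s t := by
  have hs : 0 < s := ht.trans_le h
  have h1 := Real.le_log_one_add_of_nonneg (x := (s - t) / t) (by
    apply div_nonneg <;> linarith)
  have h2 : 1 + (s - t) / t = s / t := by field_simp; ring
  rw [h2, Real.log_div hs.ne' ht.ne'] at h1
  have h3 : 2 * ((s - t) / t) / ((s - t) / t + 2) = 2 * (s - t) / (s + t) := by
    have : (s - t) / t + 2 = (s + t) / t := by field_simp; ring
    rw [this]; field_simp
  rw [h3] at h1
  have h4 := mul_le_mul_of_nonneg_left h1 hs.le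
  have h5 : (s - t) ^ 2 / (s + t) = s * (2 * (s - t) / (s + t)) - s + t := by
    field_simp; ring
  unfold entDiv
  rw [h5]; linarith

/-- With `a = log (t/s) ≥ 0`, this is `a ≤ sinh a`, multiplied by `s`; the case `s = 0` is separate.
-/
theorem entDiv_ge_of_ge {s t : ℝ} (hs : 0 ≤ s) (ht : 0 < t) (h : s ≤ t) :
    (s - t) ^ 2 / (2 * t) ≤ entDiv s t := by
  rcases hs.eq_or_lt with rfl | hs
  · unfold entDiv
    rw [div_le_iff₀ (by positivity)]
    nlinarith
  · have hlog : 0 ≤ Real.log (t / s) := Real.log_nonneg (by rwa [le_div_iff₀ hs, one_mul])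
    have h1 := Real.self_le_sinh_iff.2 hlog
    rw [Real.sinh_log (by positivity), Real.log_div ht.ne' hs.ne'] at h1
    have h4 := mul_le_mul_of_nonneg_left h1 hs.le
    have h5 : (s - t) ^ 2 / (2 * t) = -(s * ((t / s - (t / s)⁻¹) / 2)) - s + t := by
      field_simp; ring
    unfold entDiv
    rw [h5]; linarith

theorem entDiv_nonneg {s t : ℝ} (hs : 0 ≤ s) (ht : 0 < t) : 0 ≤ entDiv s t := by
  rcases le_total t s with h | h
  · exact le_trans (by positivity) (entDiv_ge_of_le ht h)
  · exact le_trans (by positivity) (entDiv_ge_of_ge hs ht h)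

theorem entDiv_self (t : ℝ) : entDiv t t = 0 := by unfold entDiv; ring

/-- Joint convexity of `(x, y) ↦ 2 x log x + x y²` on `[0, ∞) × [-1, 1]`. -/
theorem le_two_mul_entDiv {s t y y' : ℝ} (hs : 0 ≤ s) (ht : 0 < t)
    (hy : y ∈ Set.Icc (-1 : ℝ) 1) (hy' : y' ∈ Set.Icc (-1 : ℝ) 1) :
    -(s * (y' - y) ^ 2) - 2 * (s - t) * y * (y' - y) ≤ 2 * entDiv s t := by
  obtain ⟨hy1, hy2⟩ := hy
  obtain ⟨hy1', hy2'⟩ := hy'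
  rcases le_total t s with h | h
  · have h0 : 0 < s := ht.trans_le h
    have h1 := entDiv_ge_of_le ht h
    have h2 : (s - t) ^ 2 / (2 * s) ≤ (s - t) ^ 2 / (s + t) := by
      gcongr; linarith
    have h3 : (s - t) ^ 2 / s = 2 * ((s - t) ^ 2 / (2 * s)) := by field_simp
    -- Completing the square in `y' - y` leaves `(s - t)² y² / s`, and `y² ≤ 1`.
    have h4 : -(s * (y' - y) ^ 2) - 2 * (s - t) * y * (y' - y) ≤ (s - t) ^ 2 / s := by
      rw [le_div_iff₀ h0]
      nlinarith [sq_nonneg (s * (y' - y) + (s - t) * y),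
        mul_nonneg (sq_nonneg (s - t)) (by nlinarith : (0 : ℝ) ≤ 1 - y ^ 2)]
    linarith
  · have h1 := entDiv_ge_of_ge hs ht h
    have h3 : (s - t) ^ 2 / t = 2 * ((s - t) ^ 2 / (2 * t)) := by field_simp
    -- The left side equals `(t - s)(y' - y)(y' + y) - t (y' - y)²`; complete the square and use
    -- `|y' + y| ≤ 2`.
    have h4 : -(s * (y' - y) ^ 2) - 2 * (s - t) * y * (y' - y) ≤ (s - t) ^ 2 / t := by
      rw [le_div_iff₀ ht]
      nlinarith [sq_nonneg ((t - s) - t * ((y' - y) * (y' + y)) / 2),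
        mul_nonneg (mul_nonneg (sq_nonneg t) (sq_nonneg (y' - y)))
          (by nlinarith : (0 : ℝ) ≤ 4 - (y' + y) ^ 2)]
    linarith

/-- The convex function from which the regularizer is assembled. -/
def cellReg (x y : ℝ) : ℝ := 5 * (x * Real.log x) + x * y ^ 2

/-- A point in `[t, 2t]` has divergence at least `(s - t)²/(3t)`, and a point below `t` has at least
`(s - t)²/(2t)`. Only a point beyond `2t` falls short; then the other two lie below `t`, and their
surplus compensates because the deviations sum to zero. -/
theorem sum_sq_le_entDiv {a b c t : ℝ} (ha : 0 ≤ a) (hb : 0 ≤ b) (hc : 0 ≤ c) (ht : 0 < t)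
    (h : a + b + c = 3 * t) :
    ((a - t) ^ 2 + (b - t) ^ 2 + (c - t) ^ 2) / (3 * t) ≤
      entDiv a t + entDiv b t + entDiv c t := by
  have up : ∀ {s : ℝ}, t ≤ s → s ≤ 2 * t → (s - t) ^ 2 / (3 * t) ≤ entDiv s t := by
    intro s h1 h2
    refine le_trans ?_ (entDiv_ge_of_le ht h1)
    gcongr <;> linarith
  have one : ∀ {a b c : ℝ}, 0 ≤ a → 0 ≤ b → a ≤ t → b ≤ t → t ≤ c → a + b + c = 3 * t →
      ((a - t) ^ 2 + (b - t) ^ 2 + (c - t) ^ 2) / (3 * t) ≤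
        entDiv a t + entDiv b t + entDiv c t := by
    intro a b c ha hb hat hbt hct h
    have h1 := entDiv_ge_of_ge ha ht hat
    have h2 := entDiv_ge_of_ge hb ht hbt
    have h3 := entDiv_ge_of_le ht hct
    have h4 : (c - t) ^ 2 / (4 * t) ≤ (c - t) ^ 2 / (c + t) := by
      gcongr <;> linarith
    have h5 : ((a - t) ^ 2 + (b - t) ^ 2 + (c - t) ^ 2) / (3 * t) ≤
        (a - t) ^ 2 / (2 * t) + (b - t) ^ 2 / (2 * t) + (c - t) ^ 2 / (4 * t) := by
      have : (a - t) ^ 2 / (2 * t) + (b - t) ^ 2 / (2 * t) + (c - t) ^ 2 / (4 * t) =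
        (6 * (a - t) ^ 2 + 6 * (b - t) ^ 2 + 3 * (c - t) ^ 2) / 4 / (3 * t) := by
        field_simp; ring
      rw [this]
      gcongr
      have hc' : c - t = -((a - t) + (b - t)) := by linarith
      rw [hc']
      nlinarith [sq_nonneg ((a - t) - (b - t))]
    linarith
  have two : ∀ {a b c : ℝ}, 0 ≤ a → a ≤ t → t ≤ b → t ≤ c → a + b + c = 3 * t →
      ((a - t) ^ 2 + (b - t) ^ 2 + (c - t) ^ 2) / (3 * t) ≤
        entDiv a t + entDiv b t + entDiv c t := by
    intro a b c ha hat hbt hct h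
    have h1 := entDiv_ge_of_ge ha ht hat
    have h1' : (a - t) ^ 2 / (3 * t) ≤ (a - t) ^ 2 / (2 * t) := by
      gcongr; linarith
    have h2 := up hbt (by linarith)
    have h3 := up hct (by linarith)
    rw [add_div, add_div]
    linarith
  rcases le_total a t with h1 | h1 <;> rcases le_total b t with h2 | h2 <;>
    rcases le_total c t with h3 | h3
  · exact one ha hb h1 h2 (by linarith) h
  · exact one ha hb h1 h2 h3 h
  · have := one ha hc h1 h3 h2 (by linarith)
    convert this using 1 <;> ring
  · exact two ha h1 h2 h3 h
  · have := one hb hc h2 h3 h1 (by linarith)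
    convert this using 1 <;> ring
  · have := two hb h2 h1 h3 (by linarith)
    convert this using 1 <;> ring
  · have := two hc h3 h1 h2 (by linarith)
    convert this using 1 <;> ring
  · exact two ha (by linarith) h2 h3 h

/-- Area convexity of `5 x log x + x y²` with respect to the bilinear form `x y`. -/
theorem area_le_cellReg {x₁ x₂ x₃ y₁ y₂ y₃ : ℝ} (hx₁ : 0 ≤ x₁) (hx₂ : 0 ≤ x₂) (hx₃ : 0 ≤ x₃)
    (hy₁ : y₁ ∈ Set.Icc (-1 : ℝ) 1) (hy₂ : y₂ ∈ Set.Icc (-1 : ℝ) 1)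
    (hy₃ : y₃ ∈ Set.Icc (-1 : ℝ) 1) :
    (y₂ - y₁) * (x₂ - x₃) - (x₂ - x₁) * (y₂ - y₃) ≤
      3 * (cellReg x₁ y₁ + cellReg x₂ y₂ + cellReg x₃ y₃ -
        3 * cellReg ((x₁ + x₂ + x₃) / 3) ((y₁ + y₂ + y₃) / 3)) := by
  obtain ⟨hl₁, hu₁⟩ := hy₁
  obtain ⟨hl₂, hu₂⟩ := hy₂
  obtain ⟨hl₃, hu₃⟩ := hy₃
  set t := (x₁ + x₂ + x₃) / 3 with ht
  have ht0 : 0 ≤ t := by positivity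
  rcases ht0.eq_or_lt with h0 | htpos
  · have e1 : x₁ = 0 := by linarith
    have e2 : x₂ = 0 := by linarith
    have e3 : x₃ = 0 := by linarith
    rw [← h0, e1, e2, e3]
    simp [cellReg]
  have hsum : x₁ + x₂ + x₃ = 3 * t := by linarith
  have hE := sum_sq_le_entDiv hx₁ hx₂ hx₃ htpos hsum
  set s := (y₁ + y₂ + y₃) / 3 with hs
  have hl : -1 ≤ s := by linarith
  have hu : s ≤ 1 := by linarith
  -- Minimizing over `η` gives `-(cξ + ζ/3)²/(4t)`, and `(a + b)² ≤ (5/4) a² + 5 b²` with `c² ≤ 4`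
  -- bounds the square by `5ξ² + (5/9)ζ²`.
  have key : ∀ {η ξ ζ c : ℝ}, -2 ≤ c → c ≤ 2 →
      -(5 * ξ ^ 2 + 5 / 9 * ζ ^ 2) / (4 * t) ≤ t * η ^ 2 + η * (c * ξ + ζ / 3) := by
    intro η ξ ζ c h1 h2
    rw [div_le_iff₀ (by positivity)]
    have : c ^ 2 ≤ 4 := by nlinarith
    nlinarith [sq_nonneg (2 * t * η + (c * ξ + ζ / 3)), sq_nonneg (c * ξ / 2 - 2 * ζ / 3),
      mul_nonneg (sq_nonneg ξ) (sub_nonneg.2 this)]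
  have k1 := key (η := y₁ - s) (ξ := x₁ - t) (ζ := x₂ - x₃) (c := y₁ + s)
    (by linarith) (by linarith)
  have k2 := key (η := y₂ - s) (ξ := x₂ - t) (ζ := x₃ - x₁) (c := y₂ + s)
    (by linarith) (by linarith)
  have k3 := key (η := y₃ - s) (ξ := x₃ - t) (ζ := x₁ - x₂) (c := y₃ + s)
    (by linarith) (by linarith)
  have hx3 : x₃ = 3 * t - x₁ - x₂ := by linarith
  have hy3 : y₃ = 3 * s - y₁ - y₂ := by linarith
  -- The squared pairwise differences sum to three times the squared deviations, so the total loss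
  -- is exactly what five units of entropy supply; this fixes the coefficient 5 in `cellReg`.
  have hq : (-(5 * (x₁ - t) ^ 2 + 5 / 9 * (x₂ - x₃) ^ 2) / (4 * t)) +
      (-(5 * (x₂ - t) ^ 2 + 5 / 9 * (x₃ - x₁) ^ 2) / (4 * t)) +
      (-(5 * (x₃ - t) ^ 2 + 5 / 9 * (x₁ - x₂) ^ 2) / (4 * t)) =
      -(5 * (((x₁ - t) ^ 2 + (x₂ - t) ^ 2 + (x₃ - t) ^ 2) / (3 * t))) := by
    rw [hx3]; field_simp; ring
  have hR : cellReg x₁ y₁ + cellReg x₂ y₂ + cellReg x₃ y₃ - 3 * cellReg t s =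
      5 * (entDiv x₁ t + entDiv x₂ t + entDiv x₃ t) +
        (x₁ * y₁ ^ 2 + x₂ * y₂ ^ 2 + x₃ * y₃ ^ 2 - 3 * t * s ^ 2) := by
    unfold cellReg entDiv
    linear_combination (-5 * Real.log t - 5 ) * (-hsum)
  rw [hR]
  -- After centering at the means, the area form is minus the sum of `(yⱼ - s)` times the cyclic
  -- differences of the other two `x`-coordinates.
  have hA : 3 * (t * (y₁ - s) ^ 2 + (y₁ - s) * ((y₁ + s) * (x₁ - t) + (x₂ - x₃) / 3) +
      (t * (y₂ - s) ^ 2 + (y₂ - s) * ((y₂ + s) * (x₂ - t) + (x₃ - x₁) / 3)) +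
      (t * (y₃ - s) ^ 2 + (y₃ - s) * ((y₃ + s) * (x₃ - t) + (x₁ - x₂) / 3))) =
      3 * (x₁ * y₁ ^ 2 + x₂ * y₂ ^ 2 + x₃ * y₃ ^ 2 - 3 * t * s ^ 2) -
        ((y₂ - y₁) * (x₂ - x₃) - (x₂ - x₁) * (y₂ - y₃)) := by
    rw [hx3, hy3]; ring
  linarith

/-! ### Sums over cells -/

/-- Indices of the nonzero entries of the matrix `𝑨`. -/
abbrev Cell (m n : ℕ) : Type := Fin m × (((Fin n × Fin n) ⊕ (Fin n × Fin n)) ⊕ Fin n)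

/-- The primal coordinate of a cell. -/
def cellX {m n : ℕ} (z : Primal m n) (k : Cell m n) : ℝ :=
  Sum.elim (Sum.elim (z.1 k.1) (z.1 k.1)) z.2 k.2

/-- The dual coordinate of a cell. -/
def cellY {m n : ℕ} (y : Dual m n) (k : Cell m n) : ℝ :=
  Sum.elim (Sum.elim (fun e => y k.1 (Sum.inl e.1)) (fun e => y k.1 (Sum.inr e.2)))
    (fun a => y k.1 (Sum.inl a)) k.2

/-- The sign of the entry of `𝑨` at a cell. -/
def cellSign {m n : ℕ} (k : Cell m n) : ℝ :=
  Sum.elim (fun _ => 1) (fun _ => -1) k.2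

/-- The vectors `A xᵢ + (p, 0)`. -/
def marg {m n : ℕ} (z : Primal m n) : Dual m n := fun i =>
  Sum.elim (fun a => ∑ b, z.1 i (a, b) + z.2 a) (fun b => ∑ a, z.1 i (a, b))

/-- The inner product on `ℝ^{m n² + n}`. -/
def pairP {m n : ℕ} (v z : Primal m n) : ℝ := ∑ i, ∑ e, v.1 i e * z.1 i e + ∑ a, v.2 a * z.2 a

/-- The inner product on `ℝ^{2 m n}`. -/
def pairD {m n : ℕ} (u y : Dual m n) : ℝ := ∑ i, ∑ j, u i j * y i j

/-- The regularizer `r`. -/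
def reg {m n : ℕ} (D : ℝ) (z : Primal m n) (y : Dual m n) : ℝ :=
  2 * D / m * ∑ k, cellReg (cellX z k) (cellY y k)

/-- The objective of a proximal step. -/
def obj {m n : ℕ} (D : ℝ) (v : Primal m n) (u : Dual m n) (z : Primal m n) (y : Dual m n) : ℝ :=
  pairP v z + pairD u y + reg D z y

theorem sum_cell {m n : ℕ} (f : Cell m n → ℝ) :
    ∑ k, f k = ∑ i, (∑ e, (f (i, Sum.inl (Sum.inl e)) + f (i, Sum.inl (Sum.inr e))) +
      ∑ a, f (i, Sum.inr a)) := by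
  simp only [Fintype.sum_prod_type, Fintype.sum_sum_type, Finset.sum_add_distrib]

theorem sum_cellX {m n : ℕ} (z : Primal m n) :
    ∑ k, cellX z k = 2 * ∑ i, ∑ e, z.1 i e + m * ∑ a, z.2 a := by
  rw [sum_cell]
  simp only [cellX, Sum.elim_inl, Sum.elim_inr, Finset.sum_add_distrib, Finset.sum_const,
    Finset.card_univ, Fintype.card_fin, nsmul_eq_mul]
  ring

theorem sum_cellX_mul_cellY {m n : ℕ} (z : Primal m n) (y : Dual m n) :
    ∑ k, cellX z k * cellY y k = pairD (marg z) y := by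
  rw [sum_cell, pairD]
  refine Finset.sum_congr rfl fun i _ => ?_
  simp only [cellX, cellY, Sum.elim_inl, Sum.elim_inr, marg, Fintype.sum_sum_type,
    Finset.sum_add_distrib, Fintype.sum_prod_type, add_mul, Finset.sum_mul]
  rw [Finset.sum_comm (f := fun a b => z.1 i (a, b) * y i (Sum.inr b))]
  ring

theorem cellX_nonneg {m n : ℕ} {z : Primal m n} (hz : z ∈ primalSet m n) (k : Cell m n) :
    0 ≤ cellX z k := by
  rcases k with ⟨i, (e | e) | a⟩
  exacts [(hz.1 i).1 e, (hz.1 i).1 e, hz.2.1 a]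

theorem cellY_mem {m n : ℕ} {y : Dual m n} (hy : y ∈ dualSet m n) (k : Cell m n) :
    cellY y k ∈ Set.Icc (-1 : ℝ) 1 := by
  rcases k with ⟨i, (e | e) | a⟩ <;> exact hy _ _

theorem sum_cellX_of_mem {m n : ℕ} {z : Primal m n} (hz : z ∈ primalSet m n) :
    ∑ k, cellX z k = 3 * m := by
  rw [sum_cellX, hz.2.2, Finset.sum_congr rfl fun i _ => (hz.1 i).2]
  simp; ring

/-- Transfers entropies and divergences between cells and coordinates, with multiplicity 2 for plan
entries and `m` for entries of `p`. -/
theorem sum_cell_map₂ {m n : ℕ} (h : ℝ → ℝ → ℝ) (z z' : Primal m n) :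
    ∑ k, h (cellX z k) (cellX z' k) =
      2 * ∑ i, ∑ e, h (z.1 i e) (z'.1 i e) + m * ∑ a, h (z.2 a) (z'.2 a) := by
  rw [← sum_cellX (fun i e => h (z.1 i e) (z'.1 i e), fun a => h (z.2 a) (z'.2 a))]
  refine Finset.sum_congr rfl fun k _ => ?_
  rcases k with ⟨i, (e | e) | a⟩ <;> rfl

theorem pairD_marg_sq {m n : ℕ} (z : Primal m n) (y : Dual m n) :
    ∑ k, cellX z k * cellY y k ^ 2 = pairD (marg z) (fun i j => y i j ^ 2) := by
  rw [← sum_cellX_mul_cellY]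
  refine Finset.sum_congr rfl fun k _ => ?_
  rcases k with ⟨i, (e | e) | a⟩ <;> rfl

theorem reg_eq {m n : ℕ} (D : ℝ) (z : Primal m n) (y : Dual m n) :
    reg D z y = 2 * D / m * (5 * (2 * ∑ i, ∑ e, z.1 i e * Real.log (z.1 i e) +
      m * ∑ a, z.2 a * Real.log (z.2 a)) + pairD (marg z) (fun i j => y i j ^ 2)) := by
  rw [reg, ← pairD_marg_sq, ← sum_cell_map₂ (fun s _ => s * Real.log s) z z]
  simp only [cellReg, Finset.sum_add_distrib, Finset.mul_sum]

/-! ### The two half-steps of alternating minimization -/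

/-- `exp(-g) / ∑ⱼ [exp(-g)]ⱼ`. -/
def gibbs {ι : Type} [Fintype ι] (g : ι → ℝ) : ι → ℝ :=
  fun j => Real.exp (-g j) / ∑ l, Real.exp (-g l)

section Gibbs

variable {ι : Type} [Fintype ι] [Nonempty ι]

theorem sum_exp_pos (g : ι → ℝ) : 0 < ∑ l, Real.exp (-g l) :=
  Finset.sum_pos (fun _ _ => Real.exp_pos _) Finset.univ_nonempty

theorem gibbs_pos (g : ι → ℝ) (j : ι) : 0 < gibbs g j :=
  div_pos (Real.exp_pos _) (sum_exp_pos g)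

theorem gibbs_mem (g : ι → ℝ) : gibbs g ∈ stdSimplex ℝ ι := by
  refine ⟨fun j => (gibbs_pos g j).le, ?_⟩
  unfold gibbs
  rw [← Finset.sum_div, div_self (sum_exp_pos g).ne']

theorem log_gibbs (g : ι → ℝ) (j : ι) :
    Real.log (gibbs g j) = -g j - Real.log (∑ l, Real.exp (-g l)) := by
  rw [gibbs, Real.log_div (Real.exp_pos _).ne' (sum_exp_pos g).ne', Real.log_exp]

theorem sum_mul_add_log_eq (g : ι → ℝ) {x : ι → ℝ} (hx : x ∈ stdSimplex ℝ ι) :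
    ∑ j, x j * (g j + Real.log (x j)) =
      ∑ j, entDiv (x j) (gibbs g j) - Real.log (∑ l, Real.exp (-g l)) := by
  have h1 : ∀ j, entDiv (x j) (gibbs g j) = x j * (g j + Real.log (x j)) +
      x j * Real.log (∑ l, Real.exp (-g l)) - x j + gibbs g j := by
    intro j
    rw [entDiv, log_gibbs]; ring
  simp only [h1, Finset.sum_add_distrib, Finset.sum_sub_distrib, ← Finset.sum_mul, hx.2,
    (gibbs_mem g).2]
  ring

/-- Linear form plus entropy equals, on the simplex, relative entropy to the Gibbs vector up to a
constant. This gives both optimality of the Gibbs vector and the exact remainder. -/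
theorem gibbs_three_point (g : ι → ℝ) {x : ι → ℝ} (hx : x ∈ stdSimplex ℝ ι) :
    ∑ j, x j * (g j + Real.log (x j)) =
      ∑ j, gibbs g j * (g j + Real.log (gibbs g j)) + ∑ j, entDiv (x j) (gibbs g j) := by
  rw [sum_mul_add_log_eq g hx, sum_mul_add_log_eq g (gibbs_mem g)]
  simp only [entDiv_self, Finset.sum_const_zero]
  ring

end Gibbs

/-- The exponents of the multiplicative step. -/
def expo {m n : ℕ} (D : ℝ) (v : Primal m n) (y : Dual m n) : Primal m n :=
  (fun i e => m / (20 * D) * v.1 i e +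
      1 / 10 * (y i (Sum.inl e.1) * y i (Sum.inl e.1) + y i (Sum.inr e.2) * y i (Sum.inr e.2)),
    fun a => 1 / (10 * D) * v.2 a +
      1 / (5 * m) * ∑ i, y i (Sum.inl a) * y i (Sum.inl a))

/-- The minimizer over `𝒳` for given `𝐲`. -/
def stepX {m n : ℕ} (D : ℝ) (v : Primal m n) (y : Dual m n) : Primal m n :=
  (fun i => gibbs ((expo D v y).1 i), gibbs (expo D v y).2)

/-- The minimizer over `𝒴` for given `𝐱`. -/
def stepY {m n : ℕ} (D : ℝ) (u : Dual m n) (z : Primal m n) : Dual m n := fun i j =>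
  max (-1) (min 1 (-(m / (4 * D)) * (u i j / marg z i j)))

theorem amStep_val {m n : ℕ} (D : ℝ) (v : Primal m n) (u : Dual m n) (w : Primal m n × Dual m n) :
    (amStep D v u w).val = (stepX D v w.2, stepY D u (stepX D v w.2)) := by
  refine Prod.ext rfl ?_
  funext i j
  rcases j with a | b <;> rfl

theorem stepX_mem {m n : ℕ} (hn : 0 < n) (D : ℝ) (v : Primal m n) (y : Dual m n) :
    stepX D v y ∈ primalSet m n := by
  have : Nonempty (Fin n) := ⟨⟨0, hn⟩⟩
  exact ⟨fun i => gibbs_mem _, gibbs_mem _⟩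

theorem cellX_stepX_pos {m n : ℕ} (hn : 0 < n) (D : ℝ) (v : Primal m n) (y : Dual m n)
    (k : Cell m n) : 0 < cellX (stepX D v y) k := by
  have : Nonempty (Fin n) := ⟨⟨0, hn⟩⟩
  rcases k with ⟨i, (e | e) | a⟩ <;> exact gibbs_pos _ _

theorem stepY_mem {m n : ℕ} (D : ℝ) (u : Dual m n) (z : Primal m n) :
    stepY D u z ∈ dualSet m n := fun i j =>
  ⟨le_max_left _ _, max_le (by norm_num) (min_le_left _ _)⟩

/-- For fixed `y` the objective separates into linear-plus-entropy problems on the individual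
simplices, whose linear coefficients are the entries of `expo`. -/
theorem obj_eq_sum_expo {m n : ℕ} (hm : 0 < m) {D : ℝ} (hD : 0 < D) (v : Primal m n)
    (u : Dual m n) (z : Primal m n) (y : Dual m n) :
    obj D v u z y = pairD u y +
      20 * D / m * ∑ i, ∑ e, z.1 i e * ((expo D v y).1 i e + Real.log (z.1 i e)) +
      10 * D * ∑ a, z.2 a * ((expo D v y).2 a + Real.log (z.2 a)) := by
  have hm' : (m : ℝ) ≠ 0 := by positivity
  have h1 : pairD (marg z) (fun i j => y i j ^ 2) =
      ∑ i, ∑ e, z.1 i e * (y i (Sum.inl e.1) * y i (Sum.inl e.1) +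
        y i (Sum.inr e.2) * y i (Sum.inr e.2)) +
      ∑ a, z.2 a * ∑ i, y i (Sum.inl a) * y i (Sum.inl a) := by
    rw [← pairD_marg_sq, sum_cell, Finset.sum_add_distrib]
    simp only [cellX, cellY, Sum.elim_inl, Sum.elim_inr, Finset.mul_sum]
    rw [Finset.sum_comm (f := fun i a => z.2 a * y i (Sum.inl a) ^ 2)]
    simp only [mul_add, sq]
  have h2 : ∀ i e, z.1 i e * ((expo D v y).1 i e + Real.log (z.1 i e)) =
      m / (20 * D) * (v.1 i e * z.1 i e) + 1 / 10 * (z.1 i e * (y i (Sum.inl e.1) *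
        y i (Sum.inl e.1) + y i (Sum.inr e.2) * y i (Sum.inr e.2))) +
      z.1 i e * Real.log (z.1 i e) := by
    intro i e; simp only [expo]; ring
  have h3 : ∀ a, z.2 a * ((expo D v y).2 a + Real.log (z.2 a)) =
      1 / (10 * D) * (v.2 a * z.2 a) + 1 / (5 * m) * (z.2 a * ∑ i, y i (Sum.inl a) *
        y i (Sum.inl a)) + z.2 a * Real.log (z.2 a) := by
    intro i; simp only [expo]; ring
  rw [obj, reg_eq, h1, pairP]
  simp only [h2, h3, Finset.sum_add_distrib, ← Finset.mul_sum]
  field_simp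
  ring

/-- The multiplicative step is an exact minimization, with remainder. -/
theorem obj_stepX {m n : ℕ} (hm : 0 < m) (hn : 0 < n) {D : ℝ} (hD : 0 < D) (v : Primal m n)
    (u : Dual m n) {z : Primal m n} (hz : z ∈ primalSet m n) (y : Dual m n) :
    obj D v u z y = obj D v u (stepX D v y) y +
      10 * D / m * ∑ k, entDiv (cellX z k) (cellX (stepX D v y) k) := by
  have : Nonempty (Fin n) := ⟨⟨0, hn⟩⟩
  have hm' : (m : ℝ) ≠ 0 := by positivity
  rw [obj_eq_sum_expo hm hD, obj_eq_sum_expo hm hD, sum_cell_map₂,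
    Finset.sum_congr rfl fun i _ => gibbs_three_point ((expo D v y).1 i) (hz.1 i),
    gibbs_three_point (expo D v y).2 hz.2]
  simp only [Finset.sum_add_distrib, stepX]
  field_simp
  ring

theorem marg_pos {m n : ℕ} (hn : 0 < n) {z : Primal m n} (hz : ∀ k, 0 < cellX z k)
    (i : Fin m) (j : Fin n ⊕ Fin n) : 0 < marg z i j := by
  have : Nonempty (Fin n) := ⟨⟨0, hn⟩⟩
  rcases j with a | b
  · exact add_pos (Finset.sum_pos (fun b _ => hz (i, Sum.inl (Sum.inl (a, b))))
      Finset.univ_nonempty) (hz (i, Sum.inr a))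
  · exact Finset.sum_pos (fun a _ => hz (i, Sum.inl (Sum.inl (a, b)))) Finset.univ_nonempty

/-- The unconstrained minimizer is `τ = -u/(2cw)`, and its projection satisfies the variational
inequality `0 ≤ (y - τ)(y' - y)`; the quadratic remainder comes from strong convexity. -/
theorem clip_optimal {c u w y' : ℝ} (hc : 0 < c) (hw : 0 < w) (hy' : y' ∈ Set.Icc (-1 : ℝ) 1)
    {y : ℝ} (hy : y = max (-1) (min 1 (-(1 / (2 * c)) * (u / w)))) :
    u * y + c * (w * y ^ 2) + c * (w * (y' - y) ^ 2) ≤ u * y' + c * (w * y' ^ 2) := by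
  obtain ⟨h1, h2⟩ := hy'
  have hcw : 0 < c * w := mul_pos hc hw
  set τ := -(1 / (2 * c)) * (u / w) with hτ
  have hu : u = -(2 * (c * w) * τ) := by rw [hτ]; field_simp
  suffices h : 0 ≤ (y - τ) * (y' - y) by
    rw [hu]; nlinarith [mul_nonneg hcw.le h]
  rcases le_total τ 1 with h3 | h3
  · rw [min_eq_right h3] at hy
    rcases le_total (-1) τ with h4 | h4
    · rw [max_eq_right h4] at hy
      rw [hy]; simp
    · rw [max_eq_left h4] at hy
      rw [hy]; apply mul_nonneg <;> linarith
  · rw [min_eq_left h3, max_eq_right (by norm_num)] at hy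
    rw [hy]; nlinarith

/-- The projection step is an exact minimization, with remainder. -/
theorem obj_stepY {m n : ℕ} (hm : 0 < m) (hn : 0 < n) {D : ℝ} (hD : 0 < D)
    (u : Dual m n) {z : Primal m n} (hz : ∀ k, 0 < cellX z k) {y : Dual m n}
    (hy : y ∈ dualSet m n) :
    pairD u (stepY D u z) + 2 * D / m * ∑ k, cellX z k * cellY (stepY D u z) k ^ 2 +
      2 * D / m * ∑ k, cellX z k * (cellY y k - cellY (stepY D u z) k) ^ 2 ≤
      pairD u y + 2 * D / m * ∑ k, cellX z k * cellY y k ^ 2 := by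
  have h1 : ∑ k, cellX z k * (cellY y k - cellY (stepY D u z) k) ^ 2 =
      pairD (marg z) (fun i j => (y i j - stepY D u z i j) ^ 2) := by
    rw [← pairD_marg_sq z (fun i j => y i j - stepY D u z i j)]
    refine Finset.sum_congr rfl fun k _ => ?_
    rcases k with ⟨i, (e | e) | a⟩ <;> rfl
  rw [h1, pairD_marg_sq, pairD_marg_sq]
  simp only [pairD, Finset.mul_sum, ← Finset.sum_add_distrib]
  refine Finset.sum_le_sum fun i _ => Finset.sum_le_sum fun j _ => ?_
  refine clip_optimal (by positivity) (marg_pos hn hz i j) (hy i j) ?_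
  have : (1 : ℝ) / (2 * (2 * D / m)) = m / (4 * D) := by field_simp; norm_num
  rw [this]; rfl

/-! ### Linear convergence of alternating minimization -/

theorem obj_eq_add {m n : ℕ} (D : ℝ) (v : Primal m n) (u : Dual m n) (z : Primal m n)
    (y : Dual m n) :
    obj D v u z y = pairP v z + 2 * D / m * ∑ k, 5 * (cellX z k * Real.log (cellX z k)) +
      (pairD u y + 2 * D / m * ∑ k, cellX z k * cellY y k ^ 2) := by
  simp only [obj, reg, cellReg, Finset.sum_add_distrib, mul_add]
  ring

theorem obj_stepY_le {m n : ℕ} (hm : 0 < m) (hn : 0 < n) {D : ℝ} (hD : 0 < D) (v : Primal m n)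
    (u : Dual m n) {z : Primal m n} (hz : ∀ k, 0 < cellX z k) {y : Dual m n}
    (hy : y ∈ dualSet m n) : obj D v u z (stepY D u z) ≤ obj D v u z y := by
  have h := obj_stepY hm hn hD u hz hy
  have h2 : 0 ≤ 2 * D / m * ∑ k, cellX z k * (cellY y k - cellY (stepY D u z) k) ^ 2 :=
    mul_nonneg (by positivity)
      (Finset.sum_nonneg fun k _ => mul_nonneg (hz k).le (sq_nonneg _))
  rw [obj_eq_add, obj_eq_add]
  linarith

/-- Replacing `𝐲'` by the best response to `z` costs at most a fraction of the divergence. -/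
theorem obj_le_add_entDiv {m n : ℕ} (hm : 0 < m) (hn : 0 < n) {D : ℝ} (hD : 0 < D)
    (v : Primal m n) (u : Dual m n) {z z' : Primal m n} (hz : ∀ k, 0 < cellX z k)
    (hz' : z' ∈ primalSet m n) {y' : Dual m n} (hy' : y' ∈ dualSet m n) :
    obj D v u z' (stepY D u z) ≤ obj D v u z' y' +
      2 / 5 * (10 * D / m * ∑ k, entDiv (cellX z' k) (cellX z k)) := by
  have h := obj_stepY hm hn hD u hz hy'
  set y := stepY D u z with hy
  have hc : (0 : ℝ) ≤ 2 * D / m := by positivity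
  -- Adding the optimality remainder of `y` at `z` to the change of `x` from `z` to `z'` leaves
  -- exactly the expression controlled by joint convexity, cell by cell.
  have key : 2 * D / m * ∑ k, (-(cellX z' k * (cellY y' k - cellY y k) ^ 2) -
      2 * (cellX z' k - cellX z k) * cellY y k * (cellY y' k - cellY y k)) ≤
      2 * D / m * ∑ k, 2 * entDiv (cellX z' k) (cellX z k) := by
    refine mul_le_mul_of_nonneg_left (Finset.sum_le_sum fun k _ => ?_) hc
    exact le_two_mul_entDiv (cellX_nonneg hz' k) (hz k) (cellY_mem (stepY_mem D u z) k)
      (cellY_mem hy' k)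
  have e : ∑ k, (-(cellX z' k * (cellY y' k - cellY y k) ^ 2) -
      2 * (cellX z' k - cellX z k) * cellY y k * (cellY y' k - cellY y k)) =
      ∑ k, cellX z' k * cellY y k ^ 2 - ∑ k, cellX z' k * cellY y' k ^ 2 +
      (∑ k, cellX z k * cellY y' k ^ 2 - ∑ k, cellX z k * cellY y k ^ 2 -
        ∑ k, cellX z k * (cellY y' k - cellY y k) ^ 2) := by
    simp only [← Finset.sum_add_distrib, ← Finset.sum_sub_distrib]
    refine Finset.sum_congr rfl fun k _ => ?_
    ring
  rw [e, ← Finset.mul_sum] at key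
  have e2 : 2 / 5 * (10 * D / m * ∑ k, entDiv (cellX z' k) (cellX z k)) =
      2 * D / m * (2 * ∑ k, entDiv (cellX z' k) (cellX z k)) := by ring
  rw [obj_eq_add, obj_eq_add, e2]
  simp only [mul_add, mul_sub] at key
  linarith

/-! ### Compactness, existence of proximal minimizers, and the iterates -/

theorem isCompact_primalSet (m n : ℕ) : IsCompact (primalSet m n) := by
  have : primalSet m n =
      (Set.univ.pi fun _ => stdSimplex ℝ (Fin n × Fin n)) ×ˢ stdSimplex ℝ (Fin n) := by
    ext z; simp [primalSet, Set.mem_pi]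
  rw [this]
  exact (isCompact_univ_pi fun _ => isCompact_stdSimplex ℝ _).prod (isCompact_stdSimplex ℝ _)

theorem isCompact_dualSet (m n : ℕ) : IsCompact (dualSet m n) := by
  have : dualSet m n = Set.univ.pi fun _ => Set.univ.pi fun _ => Set.Icc (-1 : ℝ) 1 := by
    ext z; simp only [dualSet, Set.mem_ofPred_eq, Set.mem_pi, Set.mem_univ, true_implies]
  rw [this]
  exact isCompact_univ_pi fun _ => isCompact_univ_pi fun _ => isCompact_Icc

theorem zero_mem_dualSet (m n : ℕ) : (0 : Dual m n) ∈ dualSet m n := fun i j => by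
  simp

theorem continuous_cellX {m n : ℕ} (k : Cell m n) :
    Continuous fun z : Primal m n => cellX z k := by
  rcases k with ⟨i, (e | e) | a⟩ <;> simp only [cellX, Sum.elim_inl, Sum.elim_inr] <;> fun_prop

theorem continuous_cellY {m n : ℕ} (k : Cell m n) :
    Continuous fun y : Dual m n => cellY y k := by
  rcases k with ⟨i, (e | e) | a⟩ <;> simp only [cellY, Sum.elim_inl, Sum.elim_inr] <;> fun_prop

theorem continuous_obj {m n : ℕ} (D : ℝ) (v : Primal m n) (u : Dual m n) :
    Continuous fun w : Primal m n × Dual m n => obj D v u w.1 w.2 := by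
  have hx : ∀ k, Continuous fun w : Primal m n × Dual m n => cellX w.1 k := fun k =>
    (continuous_cellX k).comp continuous_fst
  have hy : ∀ k, Continuous fun w : Primal m n × Dual m n => cellY w.2 k := fun k =>
    (continuous_cellY k).comp continuous_snd
  have hl : ∀ k, Continuous fun w : Primal m n × Dual m n =>
      cellX w.1 k * Real.log (cellX w.1 k) := fun k => Real.continuous_mul_log.comp (hx k)
  simp only [obj, pairP, pairD, reg, cellReg]
  fun_prop

theorem exists_obj_minimizer {m n : ℕ} (hn : 0 < n) (D : ℝ) (v : Primal m n) (u : Dual m n) :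
    ∃ z ∈ primalSet m n, ∃ y ∈ dualSet m n, ∀ z' ∈ primalSet m n, ∀ y' ∈ dualSet m n,
      obj D v u z y ≤ obj D v u z' y' := by
  obtain ⟨w, hw, h⟩ := ((isCompact_primalSet m n).prod (isCompact_dualSet m n)).exists_isMinOn
    ⟨(stepX D v 0, 0), stepX_mem hn D v 0, zero_mem_dualSet m n⟩ (continuous_obj D v u).continuousOn
  exact ⟨w.1, hw.1, w.2, hw.2, fun z' hz' y' hy' => 
    isMinOn_iff.1 h (z', y') (Set.mk_mem_prod hz' hy')⟩

/-- The iterates of alternating minimization. -/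
def amSeq {m n : ℕ} (D : ℝ) (v : Primal m n) (u : Dual m n) : ℕ → Primal m n × Dual m n
  | 0 => ((fun _ _ => 1 / (n * n), fun _ => 1 / n), 0)
  | k + 1 => (stepX D v (amSeq D v u k).2, stepY D u (stepX D v (amSeq D v u k).2))

theorem altMin_val {m n : ℕ} (D : ℝ) (M : ℕ) (v : Primal m n) (u : Dual m n) :
    (altMin D M v u).val = amSeq D v u M := by
  have : (altMin D M v u).val =
    (iter (amStep D v u) M ((fun _ _ => 1 / (n * n), fun _ => 1 / n), 0)).val := rfl
  rw [this]
  induction M with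
  | zero => rfl
  | succ k ih =>
    have : ∀ w, (iter (amStep D v u) (k + 1) w).val =
      (amStep D v u (iter (amStep D v u) k w).val).val := fun _ => rfl
    rw [this, ih rfl, amStep_val]
    rfl

theorem amSeq_mem {m n : ℕ} (hn : 0 < n) (D : ℝ) (v : Primal m n) (u : Dual m n) (k : ℕ) :
    (amSeq D v u k).1 ∈ primalSet m n ∧ (amSeq D v u k).2 ∈ dualSet m n := by
  cases k with
  | zero =>
    have : (n : ℝ) ≠ 0 := by positivity
    refine ⟨⟨fun i => ⟨fun e => ?_, ?_⟩, fun a => ?_, ?_⟩, zero_mem_dualSet m n⟩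
    · simp only [amSeq]; positivity
    · simp [amSeq]; field_simp
    · simp only [amSeq]; positivity
    · simp [amSeq, this]
  | succ k => exact ⟨stepX_mem hn _ _ _, stepY_mem _ _ _⟩

/-- Let `Eⱼ` be the weighted divergence of the minimizer from iterate `j + 1`. Exactness of the
half-steps makes the next suboptimality plus `Eⱼ₊₁` at most `(2/5) Eⱼ`. Since suboptimality is
nonnegative, `Eⱼ` contracts, and the same inequality then bounds suboptimality. -/
theorem amSeq_converges {m n : ℕ} (hm : 0 < m) (hn : 0 < n) {D : ℝ} (hD : 0 < D)
    (v : Primal m n) (u : Dual m n) (k : ℕ) {z : Primal m n} (hz : z ∈ primalSet m n)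
    {y : Dual m n} (hy : y ∈ dualSet m n) :
    obj D v u (amSeq D v u (k + 2)).1 (amSeq D v u (k + 2)).2 ≤
      obj D v u z y + (2 / 5) ^ (k + 1) * (6 * D) := by
  obtain ⟨zs, hzs, ys, hys, hmin⟩ := exists_obj_minimizer (m := m) hn D v u
  have hm' : (m : ℝ) ≠ 0 := by positivity
  have hc : (0 : ℝ) ≤ 2 * D / m := by positivity
  have hpos : ∀ j l, 0 < cellX (amSeq D v u (j + 1)).1 l := fun j l =>
    cellX_stepX_pos hn D v _ l
  have hbest : ∀ j, (amSeq D v u (j + 1)).2 = stepY D u (amSeq D v u (j + 1)).1 := fun j => rfl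
  have hmem := amSeq_mem hn D v u
  have descent : ∀ j, obj D v u (amSeq D v u (j + 1)).1 (amSeq D v u (j + 1)).2 +
      10 * D / m * ∑ l, entDiv (cellX zs l) (cellX (amSeq D v u (j + 1)).1 l) ≤
      obj D v u zs (amSeq D v u j).2 := by
    intro j
    rw [obj_stepX hm hn hD v u hzs (amSeq D v u j).2]
    have := obj_stepY_le hm hn hD v u (hpos j) (hmem j).2
    rw [← hbest] at this
    exact add_le_add_left this _
  -- The start `y = 0` matters: comparing the exact `x`-step at `y = 0` with optimality of `(zs,
  -- ys)` cancels all linear and entropy terms, leaving only the `x y²` terms, at most `(2D/m) ·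
  -- 3m`.
  have base : 10 * D / m * ∑ l, entDiv (cellX zs l) (cellX (amSeq D v u 1).1 l) ≤ 6 * D := by
    have h1 := obj_stepX hm hn hD v u hzs 0
    have h2 := hmin _ (hmem 1).1 _ hys
    have h3 : (amSeq D v u 1).1 = stepX D v 0 := rfl
    rw [← h3] at h1
    rw [obj_eq_add, obj_eq_add (y := ys)] at h2
    rw [obj_eq_add, obj_eq_add (y := 0)] at h1
    have h0 : ∀ l, cellY (0 : Dual m n) l = 0 := by
      rintro ⟨i, (e | e) | a⟩ <;> rfl
    have h4 : 2 * D / m * ∑ l, cellX zs l * cellY ys l ^ 2 ≥ 0 :=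
      mul_nonneg hc (Finset.sum_nonneg fun l _ =>
        mul_nonneg (cellX_nonneg hzs l) (sq_nonneg _))
    have h5 : 2 * D / m * ∑ l, cellX (amSeq D v u 1).1 l * cellY ys l ^ 2 ≤ 6 * D := by
      have : ∑ l, cellX (amSeq D v u 1).1 l * cellY ys l ^ 2 ≤ 3 * m := by
        rw [← sum_cellX_of_mem (hmem 1).1]
        refine Finset.sum_le_sum fun l _ => ?_
        obtain ⟨ha, hb⟩ := cellY_mem hys l
        exact mul_le_of_le_one_right (cellX_nonneg (hmem 1).1 l) (by nlinarith)
      calc _ ≤ 2 * D / m * (3 * m) := mul_le_mul_of_nonneg_left this hc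
        _ = 6 * D := by field_simp; norm_num
    simp only [h0, ne_eq, OfNat.ofNat_ne_zero, not_false_eq_true, zero_pow, mul_zero,
      Finset.sum_const_zero] at h1
    linarith
  have contract : ∀ j, 10 * D / m * ∑ l, entDiv (cellX zs l) (cellX (amSeq D v u (j + 1)).1 l) ≤
      (2 / 5) ^ j * (6 * D) := by
    intro j
    induction j with
    | zero => simpa using base
    | succ j ih =>
      have h1 := descent (j + 1)
      have h2 := obj_le_add_entDiv hm hn hD v u (hpos j) hzs hys
      rw [← hbest] at h2
      have h3 := hmin _ (hmem (j + 2)).1 _ (hmem (j + 2)).2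
      rw [pow_succ]
      linarith
  have h1 := descent (k + 1)
  have h2 := obj_le_add_entDiv hm hn hD v u (hpos k) hzs hys
  rw [← hbest] at h2
  have h3 := hmin z hz y hy
  have h4 := contract k
  have h5 : 0 ≤ 10 * D / m * ∑ l, entDiv (cellX zs l) (cellX (amSeq D v u (k + 2)).1 l) :=
    mul_nonneg (by positivity)
      (Finset.sum_nonneg fun l _ => entDiv_nonneg (cellX_nonneg hzs l) (hpos _ l))
  rw [pow_succ]
  linarith

/-! ### The bilinear form and the gradient operator -/

/-- `𝐲ᵀ 𝑨 𝐱`. -/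
def bilin {m n : ℕ} (z : Primal m n) (y : Dual m n) : ℝ :=
  ∑ k, cellSign k * (cellX z k * cellY y k)

theorem bigA_inl {m n : ℕ} (z : Primal m n) (i : Fin m) (a : Fin n) :
    bigA z i (Sum.inl a) = ∑ b, z.1 i (a, b) - z.2 a := by
  simp only [bigA, incidence, Pi.sub_apply, Matrix.mulVec, dotProduct, Matrix.of_apply,
    Sum.elim_inl, ite_mul, one_mul, zero_mul, Fintype.sum_prod_type]
  rw [Finset.sum_comm]
  simp

theorem bigA_inr {m n : ℕ} (z : Primal m n) (i : Fin m) (b : Fin n) :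
    bigA z i (Sum.inr b) = ∑ a, z.1 i (a, b) := by
  simp [bigA, incidence, Matrix.mulVec, dotProduct, Fintype.sum_prod_type]

theorem sum_dotProduct_bigA {m n : ℕ} (z : Primal m n) (y : Dual m n) :
    ∑ i, y i ⬝ᵥ bigA z i = bilin z y := by
  rw [bilin, sum_cell]
  refine Finset.sum_congr rfl fun i _ => ?_
  simp only [dotProduct, Fintype.sum_sum_type, bigA_inl, bigA_inr, cellX, cellY, cellSign,
    Sum.elim_inl, Sum.elim_inr, Fintype.sum_prod_type, Finset.sum_add_distrib, mul_sub,
    Finset.sum_sub_distrib, Finset.mul_sum, one_mul, neg_mul, Finset.sum_neg_distrib]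
  rw [Finset.sum_comm (f := fun b a => y i (Sum.inr b) * z.1 i (a, b))]
  simp only [mul_comm]
  ring

theorem pairP_gradX {m n : ℕ} (d : Fin n × Fin n → ℝ) (D : ℝ) (y : Dual m n) (z : Primal m n) :
    pairP (gradX d D y).val z = ∑ i, d ⬝ᵥ z.1 i + 2 * D * bilin z y := by
  have h : (gradX d D y).val = (fun i e => d e + 2 * D * (y i (Sum.inl e.1) + y i (Sum.inr e.2)),
    fun a => 2 * D * -∑ i, y i (Sum.inl a)) := rfl
  rw [h, pairP, bilin, sum_cell]
  simp only [cellX, cellY, cellSign, Sum.elim_inl, Sum.elim_inr, dotProduct,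
    Finset.sum_add_distrib, one_mul, neg_mul, Finset.sum_neg_distrib, mul_neg, Finset.mul_sum,
    Finset.sum_mul, mul_add, add_mul]
  rw [Finset.sum_comm (f := fun i a => 2 * D * (z.2 a * y i (Sum.inl a)))]
  have e1 : ∀ a b : ℝ, 2 * D * (a * b) = 2 * D * b * a := fun a b => by ring
  simp only [e1]
  ring

theorem pairD_gradY {m n : ℕ} (q : Fin m → Fin n → ℝ) (z : Primal m n) (y : Dual m n) :
    pairD (gradY q z).val y = ∑ i, bigC q i ⬝ᵥ y i - bilin z y := by
  rw [← sum_dotProduct_bigA, ← Finset.sum_sub_distrib, pairD]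
  refine Finset.sum_congr rfl fun i _ => ?_
  rw [dotProduct, dotProduct, ← Finset.sum_sub_distrib]
  refine Finset.sum_congr rfl fun j _ => ?_
  have : (gradY q z).val i j = bigC q i j - bigA z i j := by
    rcases j with a | b
    · rw [bigA_inl]; rfl
    · rw [bigA_inr]; rfl
  rw [this]; ring

/-- `⟨g(w), (z, y)⟩` for the gradient operator `g` of the saddle-point problem. -/
def gradPair {m n : ℕ} (d : Fin n × Fin n → ℝ) (D : ℝ) (q : Fin m → Fin n → ℝ)
    (w : Primal m n × Dual m n) (z : Primal m n) (y : Dual m n) : ℝ :=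
  1 / m * (∑ i, d ⬝ᵥ z.1 i + 2 * D * bilin z w.2 +
    2 * D * (∑ i, bigC q i ⬝ᵥ y i - bilin w.1 y))

theorem saddleF_eq {m n : ℕ} (C : Matrix (Fin n) (Fin n) ℝ) (q : Fin m → Fin n → ℝ)
    (z : Primal m n) (y : Dual m n) :
    saddleF C q z y = 1 / m * (∑ i, costVec C ⬝ᵥ z.1 i +
      2 * costNorm C * (bilin z y - ∑ i, bigC q i ⬝ᵥ y i)) := by
  rw [saddleF, sum_dotProduct_bigA]

/-- Exact, not merely an inequality: the objective is affine in each argument, and the bilinear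
terms at `w` itself cancel. -/
theorem gradPair_sub {m n : ℕ} (C : Matrix (Fin n) (Fin n) ℝ) (q : Fin m → Fin n → ℝ)
    (w : Primal m n × Dual m n) (z : Primal m n) (y : Dual m n) :
    gradPair (costVec C) (costNorm C) q w w.1 w.2 - gradPair (costVec C) (costNorm C) q w z y =
      saddleF C q w.1 y - saddleF C q z w.2 := by
  rw [saddleF_eq, saddleF_eq, gradPair, gradPair]; ring

theorem cellX_add {m n : ℕ} (z z' : Primal m n) (k : Cell m n) :
    cellX (z + z') k = cellX z k + cellX z' k := by
  rcases k with ⟨i, (e | e) | a⟩ <;> rfl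

theorem cellX_smul {m n : ℕ} (c : ℝ) (z : Primal m n) (k : Cell m n) :
    cellX (c • z) k = c * cellX z k := by
  rcases k with ⟨i, (e | e) | a⟩ <;> rfl

theorem cellY_add {m n : ℕ} (y y' : Dual m n) (k : Cell m n) :
    cellY (y + y') k = cellY y k + cellY y' k := by
  rcases k with ⟨i, (e | e) | a⟩ <;> rfl

theorem cellY_smul {m n : ℕ} (c : ℝ) (y : Dual m n) (k : Cell m n) :
    cellY (c • y) k = c * cellY y k := by
  rcases k with ⟨i, (e | e) | a⟩ <;> rfl

theorem isLinearMap_pairP {m n : ℕ} (v : Primal m n) : IsLinearMap ℝ (pairP v) where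
  map_add z z' := by
    simp only [pairP, Prod.fst_add, Prod.snd_add, Pi.add_apply, mul_add, Finset.sum_add_distrib]
    ring
  map_smul c z := by
    simp only [pairP, Prod.smul_fst, Prod.smul_snd, Pi.smul_apply, smul_eq_mul, mul_add,
      Finset.mul_sum, mul_left_comm]

theorem isLinearMap_pairD {m n : ℕ} (u : Dual m n) : IsLinearMap ℝ (pairD u) where
  map_add z z' := by
    simp only [pairD, Pi.add_apply, mul_add, Finset.sum_add_distrib]
  map_smul c z := by
    simp only [pairD, Pi.smul_apply, smul_eq_mul, Finset.mul_sum, mul_left_comm]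

theorem pairP_axpyP {m n : ℕ} (c : ℝ) (w v z : Primal m n) :
    pairP (axpyP c w v).val z = pairP v z + c * pairP w z := by
  have h : (axpyP c w v).val =
    (fun i e => v.1 i e + c * w.1 i e, fun a => v.2 a + c * w.2 a) := rfl
  rw [h]
  simp only [pairP, add_mul, Finset.sum_add_distrib, mul_add, Finset.mul_sum, mul_assoc]
  ring

theorem pairD_axpyD {m n : ℕ} (c : ℝ) (w v z : Dual m n) :
    pairD (axpyD c w v).val z = pairD v z + c * pairD w z := by
  have h : (axpyD c w v).val = fun i j => v i j + c * w i j := rfl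
  rw [h]
  simp only [pairD, add_mul, Finset.sum_add_distrib, Finset.mul_sum, mul_assoc]

/-! ### Area convexity and range of the regularizer -/

theorem reg_area_convex {m n : ℕ} {D : ℝ} (hD : 0 ≤ D) {a b c : Primal m n × Dual m n}
    (ha : a.1 ∈ primalSet m n ∧ a.2 ∈ dualSet m n)
    (hb : b.1 ∈ primalSet m n ∧ b.2 ∈ dualSet m n)
    (hc : c.1 ∈ primalSet m n ∧ c.2 ∈ dualSet m n) :
    2 * D / m * (bilin c.1 a.2 - bilin b.1 a.2 - bilin c.1 b.2 + bilin b.1 c.2 + bilin a.1 b.2 -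
      bilin a.1 c.2) ≤
      3 * (reg D a.1 a.2 + reg D b.1 b.2 + reg D c.1 c.2 -
        3 * reg D ((1 / 3 : ℝ) • (a.1 + b.1 + c.1)) ((1 / 3 : ℝ) • (a.2 + b.2 + c.2))) := by
  have hr : 3 * (reg D a.1 a.2 + reg D b.1 b.2 + reg D c.1 c.2 -
        3 * reg D ((1 / 3 : ℝ) • (a.1 + b.1 + c.1)) ((1 / 3 : ℝ) • (a.2 + b.2 + c.2))) =
      2 * D / m * (3 * (∑ k, cellReg (cellX a.1 k) (cellY a.2 k) +
        ∑ k, cellReg (cellX b.1 k) (cellY b.2 k) + ∑ k, cellReg (cellX c.1 k) (cellY c.2 k) -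
        3 * ∑ k, cellReg (cellX ((1 / 3 : ℝ) • (a.1 + b.1 + c.1)) k)
          (cellY ((1 / 3 : ℝ) • (a.2 + b.2 + c.2)) k))) := by
    simp only [reg]; ring
  rw [hr]
  refine mul_le_mul_of_nonneg_left ?_ (by positivity)
  simp only [bilin, Finset.mul_sum, ← Finset.sum_add_distrib, ← Finset.sum_sub_distrib]
  refine Finset.sum_le_sum fun k _ => ?_
  have ex : cellX ((1 / 3 : ℝ) • (a.1 + b.1 + c.1)) k =
      (cellX a.1 k + cellX b.1 k + cellX c.1 k) / 3 := by
    rw [cellX_smul, cellX_add, cellX_add]; ring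
  have ey : cellY ((1 / 3 : ℝ) • (a.2 + b.2 + c.2)) k =
      (cellY a.2 k + cellY b.2 k + cellY c.2 k) / 3 := by
    rw [cellY_smul, cellY_add, cellY_add]; ring
  rw [ex, ey]
  have h1 := area_le_cellReg (cellX_nonneg ha.1 k) (cellX_nonneg hb.1 k) (cellX_nonneg hc.1 k)
    (cellY_mem ha.2 k) (cellY_mem hb.2 k) (cellY_mem hc.2 k)
  -- Exchanging the outer two points negates the area form, which covers cells of sign `-1`.
  have h2 := area_le_cellReg (cellX_nonneg hc.1 k) (cellX_nonneg hb.1 k) (cellX_nonneg ha.1 k)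
    (cellY_mem hc.2 k) (cellY_mem hb.2 k) (cellY_mem ha.2 k)
  rw [show cellX c.1 k + cellX b.1 k + cellX a.1 k = cellX a.1 k + cellX b.1 k + cellX c.1 k by ring,
    show cellY c.2 k + cellY b.2 k + cellY a.2 k = cellY a.2 k + cellY b.2 k + cellY c.2 k by ring]
    at h2
  have hs : cellSign k = 1 ∨ cellSign k = -1 := by
    rcases k with ⟨i, e | a⟩
    exacts [Or.inl rfl, Or.inr rfl]
  rcases hs with hs | hs <;> rw [hs] <;> linarith

/-- Relative entropy to the uniform distribution is nonnegative. -/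
theorem neg_log_card_le {ι : Type} [Fintype ι] [Nonempty ι] {x : ι → ℝ}
    (hx : x ∈ stdSimplex ℝ ι) :
    -Real.log (Fintype.card ι) ≤ ∑ j, x j * Real.log (x j) := by
  have h := sum_mul_add_log_eq (fun _ => 0) hx
  simp only [zero_add, neg_zero, Real.exp_zero, Finset.sum_const, Finset.card_univ, nsmul_eq_mul,
    mul_one] at h
  rw [h]
  have : 0 ≤ ∑ j, entDiv (x j) (gibbs (fun _ => 0) j) :=
    Finset.sum_nonneg fun j _ => entDiv_nonneg (hx.1 j) (gibbs_pos _ j)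
  linarith

/-- Each plan has entropy at most `2 log n` and `p` at most `log n`; the constant is `50 = 2 · 5 ·
(2 · 2 + 1)`. -/
theorem le_reg {m n : ℕ} (hm : 0 < m) (hn : 0 < n) {D : ℝ} (hD : 0 ≤ D) {z : Primal m n}
    (hz : z ∈ primalSet m n) (y : Dual m n) :
    -(50 * D * Real.log n) ≤ reg D z y := by
  have : Nonempty (Fin n) := ⟨⟨0, hn⟩⟩
  have hm' : (m : ℝ) ≠ 0 := by positivity
  rw [reg_eq, ← pairD_marg_sq]
  have h1 : ∑ _i : Fin m, -(2 * Real.log n) ≤ ∑ i, ∑ e, z.1 i e * Real.log (z.1 i e) := by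
    refine Finset.sum_le_sum fun i _ => ?_
    have := neg_log_card_le (hz.1 i)
    rw [Fintype.card_prod, Fintype.card_fin, Nat.cast_mul, ← sq, Real.log_pow] at this
    exact_mod_cast this
  have h2 := neg_log_card_le hz.2
  rw [Fintype.card_fin] at h2
  have h3 : 0 ≤ ∑ k, cellX z k * cellY y k ^ 2 :=
    Finset.sum_nonneg fun k _ => mul_nonneg (cellX_nonneg hz k) (sq_nonneg _)
  simp only [Finset.sum_const, Finset.card_univ, Fintype.card_fin, nsmul_eq_mul] at h1
  have h4 : -(50 * D * Real.log n) = 2 * D / m * (5 * (2 * (m * -(2 * Real.log n)) +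
      m * -Real.log n) + 0) := by
    field_simp; ring
  rw [h4]
  gcongr

/-- The entropy terms are nonpositive, and the cell masses sum to `3m` while `y² ≤ 1`. -/
theorem reg_le {m n : ℕ} (hm : 0 < m) {D : ℝ} (hD : 0 ≤ D) {z : Primal m n}
    (hz : z ∈ primalSet m n) {y : Dual m n} (hy : y ∈ dualSet m n) :
    reg D z y ≤ 6 * D := by
  have hm' : (m : ℝ) ≠ 0 := by positivity
  have h6 : 6 * D = 2 * D / m * (3 * m) := by field_simp; ring
  rw [h6, reg, ← sum_cellX_of_mem hz]
  refine mul_le_mul_of_nonneg_left (Finset.sum_le_sum fun k _ => ?_) (by positivity)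
  have h0 := cellX_nonneg hz k
  have h1 : cellX z k ≤ 1 := by
    rcases k with ⟨i, (e | e) | a⟩
    exacts [(mem_Icc_of_mem_stdSimplex (hz.1 i) e).2, (mem_Icc_of_mem_stdSimplex (hz.1 i) e).2,
      (mem_Icc_of_mem_stdSimplex hz.2 a).2]
  obtain ⟨h2, h3⟩ := cellY_mem hy k
  have h4 := mul_nonneg h0 (by nlinarith : 0 ≤ 1 - cellY y k ^ 2)
  have h5 := Real.mul_log_nonpos h0 h1
  unfold cellReg
  linarith

theorem convex_primalSet (m n : ℕ) : Convex ℝ (primalSet m n) := by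
  have : primalSet m n =
      (Set.univ.pi fun _ => stdSimplex ℝ (Fin n × Fin n)) ×ˢ stdSimplex ℝ (Fin n) := by
    ext z; simp [primalSet, Set.mem_pi]
  rw [this]
  exact (convex_pi fun _ _ => convex_stdSimplex ℝ _).prod (convex_stdSimplex ℝ _)

theorem convex_dualSet (m n : ℕ) : Convex ℝ (dualSet m n) := by
  have : dualSet m n = Set.univ.pi fun _ => Set.univ.pi fun _ => Set.Icc (-1 : ℝ) 1 := by
    ext z; simp only [dualSet, Set.mem_ofPred_eq, Set.mem_pi, Set.mem_univ, true_implies]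
  rw [this]
  exact convex_pi fun _ _ => convex_pi fun _ _ => convex_Icc _ _

theorem third_smul_mem {E : Type*} [AddCommGroup E] [Module ℝ E] {s : Set E}
    (hs : Convex ℝ s) {a b c : E} (ha : a ∈ s) (hb : b ∈ s) (hc : c ∈ s) :
    (1 / 3 : ℝ) • (a + b + c) ∈ s := by
  have := hs.sum_mem (t := Finset.univ) (w := fun _ : Fin 3 => (1 / 3 : ℝ)) (z := ![a, b, c])
    (fun _ _ => by norm_num) (by simp) (fun i _ => by fin_cases i <;> simpa)
  simpa [Fin.sum_univ_three, smul_add] using this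

/-! ### One step of dual extrapolation -/

/-- Take the centroid of `a`, `b` and `(z, y)`. Linear terms cancel in area convexity, and the area
form is a combination of gradients at `a` and `b`. The proximal inequality for `b` removes the
gradient at `a`. Bounding `a` by the centroid, and the centroid below by `A`, leaves twice the
claim, whence `1/6 = 1/(2 · 3)` and a single `δ`. -/
theorem dual_extrapolation_step {m n : ℕ} {D : ℝ} (hD : 0 ≤ D)
    (d : Fin n × Fin n → ℝ) (q : Fin m → Fin n → ℝ) (v : Primal m n) (u : Dual m n)
    {a b : Primal m n × Dual m n}
    (ha : a.1 ∈ primalSet m n ∧ a.2 ∈ dualSet m n)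
    (hb : b.1 ∈ primalSet m n ∧ b.2 ∈ dualSet m n) {A δ : ℝ}
    (hA : ∀ z ∈ primalSet m n, ∀ y ∈ dualSet m n, A ≤ obj D v u z y)
    (hoa : ∀ z ∈ primalSet m n, ∀ y ∈ dualSet m n, obj D v u a.1 a.2 ≤ obj D v u z y + δ)
    (hob : ∀ z ∈ primalSet m n, ∀ y ∈ dualSet m n,
      obj D v u b.1 b.2 + 1 / 3 * gradPair d D q a b.1 b.2 ≤
        obj D v u z y + 1 / 3 * gradPair d D q a z y + δ)
    {z : Primal m n} (hz : z ∈ primalSet m n) {y : Dual m n} (hy : y ∈ dualSet m n) :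
    A + 1 / 6 * gradPair d D q b b.1 b.2 - δ ≤ obj D v u z y + 1 / 6 * gradPair d D q b z y := by
  have h1 := reg_area_convex hD ha hb (c := (z, y)) ⟨hz, hy⟩
  have hx := third_smul_mem (convex_primalSet m n) ha.1 hb.1 hz
  have hy' := third_smul_mem (convex_dualSet m n) ha.2 hb.2 hy
  have h2 := hA _ hx _ hy'
  have h3 := hoa _ hx _ hy'
  have h4 := hob z hz y hy
  have h5 : obj D v u ((1 / 3 : ℝ) • (a.1 + b.1 + z)) ((1 / 3 : ℝ) • (a.2 + b.2 + y)) =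
      1 / 3 * (pairP v a.1 + pairP v b.1 + pairP v z) +
      1 / 3 * (pairD u a.2 + pairD u b.2 + pairD u y) +
      reg D ((1 / 3 : ℝ) • (a.1 + b.1 + z)) ((1 / 3 : ℝ) • (a.2 + b.2 + y)) := by
    rw [obj, (isLinearMap_pairP v).map_smul, (isLinearMap_pairD u).map_smul,
      (isLinearMap_pairP v).map_add, (isLinearMap_pairP v).map_add,
      (isLinearMap_pairD u).map_add, (isLinearMap_pairD u).map_add]
    rfl
  have h6 : gradPair d D q b b.1 b.2 - gradPair d D q a b.1 b.2 - gradPair d D q b z y +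
      gradPair d D q a z y = 2 * D / m * (bilin z a.2 - bilin b.1 a.2 - bilin z b.2 +
        bilin b.1 y + bilin a.1 b.2 - bilin a.1 y) := by
    simp only [gradPair]; ring
  simp only at h1
  rw [← h6] at h1
  rw [h5] at h2 h3
  simp only [obj] at h2 h3 h4 ⊢
  linarith

theorem pairP_const {m n : ℕ} (α β : ℝ) {z : Primal m n} (hz : z ∈ primalSet m n) :
    pairP (fun _ _ => α, fun _ => β) z = m * α + β := by
  simp only [pairP, ← Finset.mul_sum]
  rw [Finset.sum_congr rfl fun i _ => (hz.1 i).2, hz.2.2]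
  simp; ring

/-- The vectors `𝐳` of an iteration of dual extrapolation. -/
def deZ {m n : ℕ} (P : Params m n) (S : State m n) : Primal m n × Dual m n :=
  amSeq P.D (axpyP (-1) P.rx S.sx).val (axpyD (-1) P.ry S.sy).val P.M

/-- The vectors `𝐰` of an iteration of dual extrapolation. -/
def deW {m n : ℕ} (q : Fin m → Fin n → ℝ) (P : Params m n) (S : State m n) :
    Primal m n × Dual m n :=
  amSeq P.D
    (axpyP (1 / (3 * m)) (gradX P.d P.D (deZ P S).2).val (axpyP (-1) P.rx S.sx).val).val
    (axpyD (2 * P.D / (3 * m)) (gradY q (deZ P S).1).val (axpyD (-1) P.ry S.sy).val).val P.M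

theorem deStep_val {m n : ℕ} (q : Fin m → Fin n → ℝ) (P : Params m n) (S : State m n) :
    (deStep q P S).val =
      ⟨(axpyP (1 / (2 * 3 * m)) (gradX P.d P.D (deW q P S).2).val S.sx).val,
        (axpyD (P.D / (3 * m)) (gradY q (deW q P S).1).val S.sy).val,
        (axpyP 1 (deW q P S).1 S.sumX).val, (axpyD 1 (deW q P S).2 S.sumY).val⟩ := by
  rw [deW, deZ, ← altMin_val, ← altMin_val]
  rfl

theorem pairP_add_pairD_deStep {m n : ℕ} (q : Fin m → Fin n → ℝ) (P : Params m n)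
    (S : State m n) (z : Primal m n) (y : Dual m n) :
    pairP (deStep q P S).val.sx z + pairD (deStep q P S).val.sy y =
      pairP S.sx z + pairD S.sy y + 1 / 6 * gradPair P.d P.D q (deW q P S) z y := by
  rw [deStep_val, pairP_axpyP, pairD_axpyD, pairP_gradX, pairD_gradY, gradPair]
  ring

theorem sumX_deStep {m n : ℕ} (q : Fin m → Fin n → ℝ) (P : Params m n) (S : State m n) :
    (deStep q P S).val.sumX = S.sumX + (deW q P S).1 := by
  rw [deStep_val]
  refine Prod.ext (funext fun i => funext fun e => ?_) (funext fun a => ?_)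
  · change S.sumX.1 i e + 1 * (deW q P S).1.1 i e = _
    rw [one_mul]; rfl
  · change S.sumX.2 a + 1 * (deW q P S).1.2 a = _
    rw [one_mul]; rfl

theorem sumY_deStep {m n : ℕ} (q : Fin m → Fin n → ℝ) (P : Params m n) (S : State m n) :
    (deStep q P S).val.sumY = S.sumY + (deW q P S).2 := by
  rw [deStep_val]
  refine funext fun i => funext fun j => ?_
  change S.sumY i j + 1 * (deW q P S).2 i j = _
  rw [one_mul]; rfl

theorem deStep_lower_bound {m n : ℕ} (hn : 0 < n) (q : Fin m → Fin n → ℝ) {P : Params m n}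
    (hD : 0 ≤ P.D) {α β : ℝ} (hrx : P.rx = (fun _ _ => α, fun _ => β)) (hry : P.ry = 0) {δ : ℝ}
    (hδ : ∀ v u, ∀ z ∈ primalSet m n, ∀ y ∈ dualSet m n,
      obj P.D v u (amSeq P.D v u P.M).1 (amSeq P.D v u P.M).2 ≤ obj P.D v u z y + δ)
    (S : State m n) {A : ℝ}
    (hA : ∀ z ∈ primalSet m n, ∀ y ∈ dualSet m n, A ≤ obj P.D S.sx S.sy z y)
    {z : Primal m n} (hz : z ∈ primalSet m n) {y : Dual m n} (hy : y ∈ dualSet m n) :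
    A + 1 / 6 * gradPair P.d P.D q (deW q P S) (deW q P S).1 (deW q P S).2 - δ ≤
      obj P.D (deStep q P S).val.sx (deStep q P S).val.sy z y := by
  -- The shift by `P.rx` is constant on each simplex, so it changes the objective on the feasible
  -- set only by a constant.
  have e1 : ∀ z ∈ primalSet m n, ∀ y, obj P.D (axpyP (-1) P.rx S.sx).val
      (axpyD (-1) P.ry S.sy).val z y = obj P.D S.sx S.sy z y - (m * α + β) := by
    intro z hz y
    have h0 : pairD (0 : Dual m n) y = 0 := by simp [pairD]
    rw [obj, pairP_axpyP, pairD_axpyD, hrx, hry, pairP_const α β hz, h0, obj]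
    ring
  have ha := amSeq_mem hn P.D (axpyP (-1) P.rx S.sx).val (axpyD (-1) P.ry S.sy).val P.M
  have hb := amSeq_mem hn P.D
    (axpyP (1 / (3 * m)) (gradX P.d P.D (deZ P S).2).val (axpyP (-1) P.rx S.sx).val).val
    (axpyD (2 * P.D / (3 * m)) (gradY q (deZ P S).1).val (axpyD (-1) P.ry S.sy).val).val P.M
  have e2 : ∀ z ∈ primalSet m n, ∀ y, obj P.D
      (axpyP (1 / (3 * m)) (gradX P.d P.D (deZ P S).2).val (axpyP (-1) P.rx S.sx).val).val
      (axpyD (2 * P.D / (3 * m)) (gradY q (deZ P S).1).val (axpyD (-1) P.ry S.sy).val).val z y =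
      obj P.D S.sx S.sy z y - (m * α + β) + 1 / 3 * gradPair P.d P.D q (deZ P S) z y := by
    intro z hz y
    rw [← e1 z hz y, obj, pairP_axpyP, pairD_axpyD _ (gradY q (deZ P S).1).val, pairP_gradX,
      pairD_gradY, gradPair, obj]
    ring
  have hoa := hδ (axpyP (-1) P.rx S.sx).val (axpyD (-1) P.ry S.sy).val
  have hob := hδ
    (axpyP (1 / (3 * m)) (gradX P.d P.D (deZ P S).2).val (axpyP (-1) P.rx S.sx).val).val
    (axpyD (2 * P.D / (3 * m)) (gradY q (deZ P S).1).val (axpyD (-1) P.ry S.sy).val).val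
  have h := dual_extrapolation_step hD P.d q S.sx S.sy (a := deZ P S) (b := deW q P S) ha hb hA
    (δ := δ) (fun z hz y hy => by
      have := hoa z hz y hy
      rw [e1 _ ha.1, e1 z hz] at this
      change obj P.D S.sx S.sy (deZ P S).1 (deZ P S).2 - _ ≤ _ at this
      linarith) (fun z hz y hy => by
      have := hob z hz y hy
      rw [e2 _ hb.1, e2 z hz] at this
      change obj P.D S.sx S.sy (deW q P S).1 (deW q P S).2 - _ +
        1 / 3 * gradPair P.d P.D q (deZ P S) (deW q P S).1 (deW q P S).2 ≤ _ at this
      linarith) hz hy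
  rw [obj, pairP_add_pairD_deStep]
  rw [obj] at h
  linarith

/-! ### The main loop -/

/-- The states of the main loop. -/
def deSeq {m n : ℕ} (q : Fin m → Fin n → ℝ) (P : Params m n) : ℕ → State m n
  | 0 => ⟨0, 0, 0, 0⟩
  | k + 1 => (deStep q P (deSeq q P k)).val

theorem iter_deStep_val {m n : ℕ} (q : Fin m → Fin n → ℝ) (P : Params m n) (N : ℕ) :
    (iter (deStep q P) N ⟨0, 0, 0, 0⟩).val = deSeq q P N := by
  induction N with
  | zero => rfl
  | succ k ih =>
    change (deStep q P (iter (deStep q P) k ⟨0, 0, 0, 0⟩).val).val = _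
    rw [ih]; rfl

theorem deSeq_sumX {m n : ℕ} (q : Fin m → Fin n → ℝ) (P : Params m n) (N : ℕ) :
    (deSeq q P N).sumX = ∑ k ∈ Finset.range N, (deW q P (deSeq q P k)).1 := by
  induction N with
  | zero => rfl
  | succ k ih => rw [Finset.sum_range_succ, ← ih, deSeq, sumX_deStep]

theorem deSeq_sumY {m n : ℕ} (q : Fin m → Fin n → ℝ) (P : Params m n) (N : ℕ) :
    (deSeq q P N).sumY = ∑ k ∈ Finset.range N, (deW q P (deSeq q P k)).2 := by
  induction N with
  | zero => rfl
  | succ k ih => rw [Finset.sum_range_succ, ← ih, deSeq, sumY_deStep]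

theorem deSeq_pair {m n : ℕ} (q : Fin m → Fin n → ℝ) (P : Params m n) (N : ℕ)
    (z : Primal m n) (y : Dual m n) :
    pairP (deSeq q P N).sx z + pairD (deSeq q P N).sy y =
      1 / 6 * ∑ k ∈ Finset.range N, gradPair P.d P.D q (deW q P (deSeq q P k)) z y := by
  induction N with
  | zero => simp [deSeq, pairP, pairD]
  | succ k ih => rw [Finset.sum_range_succ, deSeq, pairP_add_pairD_deStep, ih]; ring

/-- The regret bound of dual extrapolation with approximate proximal steps. -/
theorem deSeq_regret {m n : ℕ} (hm : 0 < m) (hn : 0 < n) (q : Fin m → Fin n → ℝ)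
    {P : Params m n} (hD : 0 ≤ P.D) {α β : ℝ} (hrx : P.rx = (fun _ _ => α, fun _ => β))
    (hry : P.ry = 0) {δ : ℝ}
    (hδ : ∀ v u, ∀ z ∈ primalSet m n, ∀ y ∈ dualSet m n,
      obj P.D v u (amSeq P.D v u P.M).1 (amSeq P.D v u P.M).2 ≤ obj P.D v u z y + δ) (N : ℕ)
    {z : Primal m n} (hz : z ∈ primalSet m n) {y : Dual m n} (hy : y ∈ dualSet m n) :
    ∑ k ∈ Finset.range N,
      (gradPair P.d P.D q (deW q P (deSeq q P k)) (deW q P (deSeq q P k)).1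
        (deW q P (deSeq q P k)).2 - gradPair P.d P.D q (deW q P (deSeq q P k)) z y) ≤
      6 * (50 * P.D * Real.log n + 6 * P.D + N * δ) := by
  -- The potential bound must hold at every feasible point, since the next iteration uses it at a
  -- centroid.
  have key : ∀ N : ℕ, ∀ z ∈ primalSet m n, ∀ y ∈ dualSet m n,
      -(50 * P.D * Real.log n) + 1 / 6 * ∑ k ∈ Finset.range N,
        gradPair P.d P.D q (deW q P (deSeq q P k)) (deW q P (deSeq q P k)).1
          (deW q P (deSeq q P k)).2 - N * δ ≤
        obj P.D (deSeq q P N).sx (deSeq q P N).sy z y := by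
    intro N
    induction N with
    | zero =>
      intro z hz y _
      have := le_reg hm hn hD hz y
      simpa [deSeq, obj, pairP, pairD] using this
    | succ k ih =>
      intro z hz y hy
      have := deStep_lower_bound hn q hD hrx hry hδ (deSeq q P k) ih hz hy
      rw [Finset.sum_range_succ]
      push_cast
      refine le_trans (le_of_eq ?_) this
      ring
  have h1 := key N z hz y hy
  rw [obj, deSeq_pair] at h1
  have h2 := reg_le hm hD hz hy
  rw [Finset.sum_sub_distrib]
  linarith

/-! ### The duality gap of the output -/

theorem isLinearMap_saddle_fst {m n : ℕ} (d : Fin n × Fin n → ℝ) (D : ℝ) (y : Dual m n) :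
    IsLinearMap ℝ fun z : Primal m n => ∑ i, d ⬝ᵥ z.1 i + 2 * D * bilin z y := by
  simp only [← pairP_gradX]
  exact isLinearMap_pairP _

theorem isLinearMap_saddle_snd {m n : ℕ} (q : Fin m → Fin n → ℝ) (z : Primal m n) :
    IsLinearMap ℝ fun y : Dual m n => ∑ i, bigC q i ⬝ᵥ y i - bilin z y := by
  simp only [← pairD_gradY]
  exact isLinearMap_pairD _

/-- The objective is affine rather than linear in `z`; the constant term survives because the
weights sum to one. -/
theorem saddleF_smul_sum_fst {m n : ℕ} (C : Matrix (Fin n) (Fin n) ℝ) (q : Fin m → Fin n → ℝ)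
    {N : ℕ} (hN : 0 < N) (w : ℕ → Primal m n) (y : Dual m n) :
    saddleF C q ((1 / N : ℝ) • ∑ k ∈ Finset.range N, w k) y =
      1 / N * ∑ k ∈ Finset.range N, saddleF C q (w k) y := by
  have hN' : (N : ℝ) ≠ 0 := by positivity
  have e : ∀ z, saddleF C q z y = 1 / m * ((∑ i, costVec C ⬝ᵥ z.1 i +
      2 * costNorm C * bilin z y) - 2 * costNorm C * ∑ i, bigC q i ⬝ᵥ y i) := by
    intro z; rw [saddleF_eq]; ring
  have hl := isLinearMap_saddle_fst (costVec C) (costNorm C) y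
  have h1 := hl.map_smul (1 / N : ℝ) (∑ k ∈ Finset.range N, w k)
  have h2 := map_sum (hl.mk' _) w (Finset.range N)
  simp only [IsLinearMap.mk'_apply] at h1 h2
  rw [e, h1, h2]
  simp only [e, ← Finset.mul_sum, Finset.sum_sub_distrib, Finset.sum_const, Finset.card_range,
    smul_eq_mul, nsmul_eq_mul]
  field_simp

theorem saddleF_smul_sum_snd {m n : ℕ} (C : Matrix (Fin n) (Fin n) ℝ) (q : Fin m → Fin n → ℝ)
    {N : ℕ} (hN : 0 < N) (z : Primal m n) (w : ℕ → Dual m n) :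
    saddleF C q z ((1 / N : ℝ) • ∑ k ∈ Finset.range N, w k) =
      1 / N * ∑ k ∈ Finset.range N, saddleF C q z (w k) := by
  have hN' : (N : ℝ) ≠ 0 := by positivity
  have e : ∀ y, saddleF C q z y = 1 / m * (∑ i, costVec C ⬝ᵥ z.1 i -
      2 * costNorm C * (∑ i, bigC q i ⬝ᵥ y i - bilin z y)) := by
    intro y; rw [saddleF_eq]; ring
  have hl := isLinearMap_saddle_snd q z
  have h1 := hl.map_smul (1 / N : ℝ) (∑ k ∈ Finset.range N, w k)
  have h2 := map_sum (hl.mk' _) w (Finset.range N)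
  simp only [IsLinearMap.mk'_apply] at h1 h2
  rw [e, h1, h2]
  simp only [e, ← Finset.mul_sum, Finset.sum_sub_distrib, Finset.sum_const, Finset.card_range,
    smul_eq_mul, nsmul_eq_mul]
  field_simp

theorem continuous_bilin {m n : ℕ} :
    Continuous fun w : Primal m n × Dual m n => bilin w.1 w.2 := by
  have hx : ∀ k, Continuous fun w : Primal m n × Dual m n => cellX w.1 k := fun k =>
    (continuous_cellX k).comp continuous_fst
  have hy : ∀ k, Continuous fun w : Primal m n × Dual m n => cellY w.2 k := fun k =>
    (continuous_cellY k).comp continuous_snd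
  simp only [bilin]
  fun_prop

theorem continuous_saddleF {m n : ℕ} (C : Matrix (Fin n) (Fin n) ℝ) (q : Fin m → Fin n → ℝ) :
    Continuous fun w : Primal m n × Dual m n => saddleF C q w.1 w.2 := by
  have := continuous_bilin (m := m) (n := n)
  simp only [saddleF_eq, dotProduct]
  fun_prop

theorem primalSet_nonempty {m n : ℕ} (hn : 0 < n) : (primalSet m n).Nonempty :=
  ⟨_, stepX_mem hn 1 0 0⟩

/-- Compactness and continuity provide the attained maximum and minimum. -/
theorem dualityGapLE_of_forall {m n : ℕ} (hn : 0 < n) (C : Matrix (Fin n) (Fin n) ℝ)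
    (q : Fin m → Fin n → ℝ) {z : Primal m n} {y : Dual m n} {ε : ℝ}
    (h : ∀ z' ∈ primalSet m n, ∀ y' ∈ dualSet m n, saddleF C q z y' - saddleF C q z' y ≤ ε) :
    DualityGapLE C q z y ε := by
  obtain ⟨y₀, hy₀, h1⟩ := (isCompact_dualSet m n).exists_isMaxOn ⟨0, zero_mem_dualSet m n⟩
    ((continuous_saddleF C q).comp (Continuous.prodMk_right z)).continuousOn
  obtain ⟨z₀, hz₀, h2⟩ := (isCompact_primalSet m n).exists_isMinOn (primalSet_nonempty hn)
    ((continuous_saddleF C q).comp (Continuous.prodMk_left y)).continuousOn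
  refine ⟨saddleF C q z y₀, saddleF C q z₀ y, ⟨⟨y₀, hy₀, rfl⟩, ?_⟩, ⟨⟨z₀, hz₀, rfl⟩, ?_⟩,
    h z₀ hz₀ y₀ hy₀⟩
  · rintro _ ⟨y', hy', rfl⟩
    exact isMaxOn_iff.1 h1 y' hy'
  · rintro _ ⟨z', hz', rfl⟩
    exact isMinOn_iff.1 h2 z' hz'

/-- The range of the objective is at most `17 ‖C‖_∞`. -/
theorem saddleF_sub_le {m n : ℕ} (hm : 0 < m) {C : Matrix (Fin n) (Fin n) ℝ}
    (hC : ∀ a b, 0 ≤ C a b) {q : Fin m → Fin n → ℝ} (hq : ∀ i, q i ∈ stdSimplex ℝ (Fin n))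
    {z z' : Primal m n} (hz : z ∈ primalSet m n) (hz' : z' ∈ primalSet m n) {y y' : Dual m n}
    (hy : y ∈ dualSet m n) (hy' : y' ∈ dualSet m n) :
    saddleF C q z y' - saddleF C q z' y ≤ 17 * costNorm C := by
  have hm' : (m : ℝ) ≠ 0 := by positivity
  have hD : 0 ≤ costNorm C := norm_nonneg _
  have hb : ∀ {z : Primal m n} {y : Dual m n}, z ∈ primalSet m n → y ∈ dualSet m n →
      |bilin z y| ≤ 3 * m := by
    intro z y hz hy
    rw [← sum_cellX_of_mem hz]
    refine (Finset.abs_sum_le_sum_abs _ _).trans (Finset.sum_le_sum fun k _ => ?_)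
    have hs : |cellSign k| = 1 := by
      rcases k with ⟨i, e | a⟩ <;> simp [cellSign]
    rw [abs_mul, hs, one_mul, abs_mul, abs_of_nonneg (cellX_nonneg hz k)]
    exact mul_le_of_le_one_right (cellX_nonneg hz k) (abs_le.2 (cellY_mem hy k))
  have hc : ∀ {y : Dual m n}, y ∈ dualSet m n → |∑ i, bigC q i ⬝ᵥ y i| ≤ m := by
    intro y hy
    have : (m : ℝ) = ∑ _i : Fin m, 1 := by simp
    rw [this]
    refine (Finset.abs_sum_le_sum_abs _ _).trans (Finset.sum_le_sum fun i _ => ?_)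
    rw [← (hq i).2, dotProduct, Fintype.sum_sum_type]
    simp only [bigC, Sum.elim_inl, Sum.elim_inr, Pi.zero_apply, zero_mul, Finset.sum_const_zero,
      zero_add]
    refine (Finset.abs_sum_le_sum_abs _ _).trans (Finset.sum_le_sum fun b _ => ?_)
    rw [abs_mul, abs_of_nonneg ((hq i).1 b)]
    exact mul_le_of_le_one_right ((hq i).1 b) (abs_le.2 (hy i _))
  have hd0 : 0 ≤ ∑ i, costVec C ⬝ᵥ z'.1 i :=
    Finset.sum_nonneg fun i _ => Finset.sum_nonneg fun e _ =>
      mul_nonneg (hC _ _) ((hz'.1 i).1 e)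
  have hd1 : ∑ i, costVec C ⬝ᵥ z.1 i ≤ m * costNorm C := by
    have : (m : ℝ) * costNorm C = ∑ _i : Fin m, costNorm C := by simp
    rw [this]
    refine Finset.sum_le_sum fun i _ => ?_
    rw [← mul_one (costNorm C), ← (hz.1 i).2, Finset.mul_sum]
    refine Finset.sum_le_sum fun e _ => mul_le_mul_of_nonneg_right ?_ ((hz.1 i).1 e)
    exact (le_abs_self _).trans (norm_le_pi_norm (costVec C) e)
  have b1 := abs_le.1 (hb hz hy')
  have b2 := abs_le.1 (hb hz' hy)
  have c1 := abs_le.1 (hc hy)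
  have c2 := abs_le.1 (hc hy')
  -- The cost term varies by at most `D`, and the factor `2D` multiplies two bilinear terms of size
  -- `3` and two terms in `𝒄` of size `1`.
  have e : 17 * costNorm C = 1 / m * (m * costNorm C + 2 * costNorm C * (8 * m)) := by
    field_simp; ring
  rw [e, saddleF_eq, saddleF_eq, ← mul_sub]
  refine mul_le_mul_of_nonneg_left ?_ (by positivity)
  have : 2 * costNorm C * ((bilin z y' - ∑ i, bigC q i ⬝ᵥ y' i) -
      (bilin z' y - ∑ i, bigC q i ⬝ᵥ y i)) ≤ 2 * costNorm C * (8 * m) :=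
    mul_le_mul_of_nonneg_left (by linarith) (by positivity)
  linarith

/-! ### Computed parameters, inner accuracy and the gap bound -/

/-- The argument of the logarithm in the number of alternating minimization steps. -/
def accuracyArg {n : ℕ} (C : Matrix (Fin n) (Fin n) ℝ) (ε : ℝ) : ℝ :=
  (88 * costNorm C / (ε * ε) + 4 / ε) * Theta C + 36 * costNorm C / ε

/-- The parameters computed by the algorithm. -/
def params {n : ℕ} (m : ℕ) (C : Matrix (Fin n) (Fin n) ℝ) (ε : ℝ) : Params m n :=
  ⟨costVec C, costNorm C, ⌈24 * Real.log (accuracyArg C ε)⌉₊,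
    (fun _ _ => 10 * costNorm C / m * (-4 * Real.log n + 2),
      fun _ => 10 * costNorm C / m * (m * (-Real.log n + 1))), 0⟩

theorem initParams_val {n : ℕ} (m : ℕ) (C : Matrix (Fin n) (Fin n) ℝ) (ε : ℝ) :
    (initParams m C ε).val = params m C ε := rfl

theorem dualExtrapolation_val {m n : ℕ} (C : Matrix (Fin n) (Fin n) ℝ) (q : Fin m → Fin n → ℝ)
    (ε : ℝ) (N : ℕ) :
    (dualExtrapolation C q ε N).val =
      ((1 / N : ℝ) • ∑ k ∈ Finset.range N, (deW q (params m C ε) (deSeq q (params m C ε) k)).1,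
        (1 / N : ℝ) • ∑ k ∈ Finset.range N,
          (deW q (params m C ε) (deSeq q (params m C ε) k)).2) := by
  rw [← deSeq_sumX, ← deSeq_sumY, ← iter_deStep_val, ← initParams_val]
  -- The average is accumulated onto the zero vector, so every coordinate has the form `0 + c * s`.
  refine Prod.ext (Prod.ext (funext fun i => funext fun e => ?_) (funext fun a => ?_))
    (funext fun i => funext fun j => ?_)
  all_goals exact zero_add _

theorem deW_mem {m n : ℕ} (hn : 0 < n) (q : Fin m → Fin n → ℝ) (P : Params m n)
    (S : State m n) : (deW q P S).1 ∈ primalSet m n ∧ (deW q P S).2 ∈ dualSet m n :=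
  amSeq_mem hn _ _ _ _

theorem smul_sum_range_mem {E : Type*} [AddCommGroup E] [Module ℝ E] {s : Set E}
    (hs : Convex ℝ s) {N : ℕ} (hN : 0 < N) {w : ℕ → E} (hw : ∀ k, w k ∈ s) :
    (1 / N : ℝ) • ∑ k ∈ Finset.range N, w k ∈ s := by
  rw [Finset.smul_sum]
  refine hs.sum_mem (fun _ _ => by positivity) ?_ fun k _ => hw k
  have : (N : ℝ) ≠ 0 := by positivity
  simp [this]

/-- Since `2/5 ≤ exp (-1/2)`, taking `24 log L` rounds gains a factor of order `L⁻¹²`, while `36 D ≤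
ε L` means that little more than `L⁻¹` is needed; eleven factors `L ≥ 2` absorb the constants. -/
theorem amSeq_accuracy {m n : ℕ} (hm : 0 < m) (hn : 0 < n) {D ε L : ℝ} (hD : 0 < D)
    (hε : 0 < ε) (hL : 2 ≤ L) (hDL : 36 * D ≤ ε * L) {M : ℕ} (hM : 24 * Real.log L ≤ M)
    (v : Primal m n) (u : Dual m n) {z : Primal m n} (hz : z ∈ primalSet m n)
    {y : Dual m n} (hy : y ∈ dualSet m n) :
    obj D v u (amSeq D v u M).1 (amSeq D v u M).2 ≤ obj D v u z y + ε / 16 := by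
  have hL0 : 0 < L := by linarith
  have hlog : Real.log 2 ≤ Real.log L := Real.log_le_log (by norm_num) hL
  have hM2 : 2 ≤ M := by
    have h1 : (2 : ℝ) ≤ M := by linarith [Real.log_two_gt_d9]
    exact_mod_cast h1
  obtain ⟨k, rfl⟩ := Nat.exists_eq_add_of_le' hM2
  refine (amSeq_converges hm hn hD v u k hz hy).trans (add_le_add_right ?_ _)
  push_cast at hM
  have h1 : (1 / 2 : ℝ) ≤ Real.exp (-(1 / 2)) := by
    linarith [Real.add_one_le_exp (-(1 / 2) : ℝ)]
  have h2 : (2 / 5 : ℝ) ^ (k + 1) ≤ 2 * (L ^ 12)⁻¹ := by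
    calc (2 / 5 : ℝ) ^ (k + 1) ≤ Real.exp (-(1 / 2)) ^ (k + 1) := by
          gcongr; linarith
      _ = Real.exp (-((k + 1) / 2)) := by
          rw [← Real.exp_nat_mul]; congr 1; push_cast; ring
      _ ≤ Real.exp (1 / 2 - 12 * Real.log L) := Real.exp_le_exp.2 (by linarith)
      _ = (Real.exp (-(1 / 2)))⁻¹ * (L ^ 12)⁻¹ := by
          rw [Real.exp_sub, ← Real.exp_neg, neg_neg, div_eq_mul_inv, mul_comm (12 : ℝ),
            Real.exp_mul, Real.exp_log hL0]
          norm_num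
      _ ≤ 2 * (L ^ 12)⁻¹ := by
          gcongr
          rw [inv_le_comm₀ (Real.exp_pos _) (by norm_num)]
          linarith
  have h3 : 2048 * L ≤ L ^ 12 := by
    have : (2 : ℝ) ^ 11 ≤ L ^ 11 := by gcongr
    calc 2048 * L = 2 ^ 11 * L := by norm_num
      _ ≤ L ^ 11 * L := by gcongr
      _ = L ^ 12 := by ring
  calc (2 / 5 : ℝ) ^ (k + 1) * (6 * D) ≤ 2 * (L ^ 12)⁻¹ * (6 * D) := by gcongr
    _ = 12 * D / L ^ 12 := by ring
    _ ≤ ε / 16 := by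
      rw [div_le_iff₀ (by positivity)]
      have := mul_le_mul_of_nonneg_left h3 hε.le
      linarith

theorem Theta_pos {n : ℕ} {C : Matrix (Fin n) (Fin n) ℝ} (hD : 0 < costNorm C) :
    0 < Theta C := by
  have := Real.log_natCast_nonneg n
  unfold Theta
  positivity

theorem dualExtrapolation_gap {m n : ℕ} (hm : 0 < m) (hn : 0 < n)
    {C : Matrix (Fin n) (Fin n) ℝ} (hC : ∀ a b, 0 ≤ C a b) (hD : 0 < costNorm C)
    {q : Fin m → Fin n → ℝ} (hq : ∀ i, q i ∈ stdSimplex ℝ (Fin n)) {ε : ℝ} (hε : 0 < ε) {N : ℕ}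
    (hN : 12 * Theta C / ε ≤ N) :
    (dualExtrapolation C q ε N).val.1 ∈ primalSet m n ∧
      (dualExtrapolation C q ε N).val.2 ∈ dualSet m n ∧
      DualityGapLE C q (dualExtrapolation C q ε N).val.1
        (dualExtrapolation C q ε N).val.2 ε := by
  have hΘ := Theta_pos hD
  have hNr : (0 : ℝ) < N := lt_of_lt_of_le (by positivity) hN
  have hN0 : 0 < N := by exact_mod_cast hNr
  have hw := fun k => deW_mem hn q (params m C ε) (deSeq q (params m C ε) k)
  have hX := smul_sum_range_mem (convex_primalSet m n) hN0 fun k => (hw k).1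
  have hY := smul_sum_range_mem (convex_dualSet m n) hN0 fun k => (hw k).2
  rw [dualExtrapolation_val]
  refine ⟨hX, hY, dualityGapLE_of_forall hn C q fun z hz y hy => ?_⟩
  have hlog := Real.log_natCast_nonneg n
  have hL36 : 36 * costNorm C ≤ ε * accuracyArg C ε := by
    have h0 : 0 ≤ (88 * costNorm C / (ε * ε) + 4 / ε) * Theta C := by positivity
    have h1 : ε * (36 * costNorm C / ε) = 36 * costNorm C := by field_simp
    have h2 := mul_nonneg hε.le h0
    rw [accuracyArg, mul_add]
    linarith
  -- If the argument is below 2, the inner iteration count may be zero; but then `18 D < ε`, and the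
  -- objective's total range is already below `ε`.
  rcases lt_or_ge (accuracyArg C ε) 2 with hL | hL
  · refine (saddleF_sub_le hm hC hq hX hz hY hy).trans ?_
    nlinarith
  · have hδ : ∀ v u, ∀ z ∈ primalSet m n, ∀ y ∈ dualSet m n,
        obj (params m C ε).D v u (amSeq (params m C ε).D v u (params m C ε).M).1
          (amSeq (params m C ε).D v u (params m C ε).M).2 ≤
        obj (params m C ε).D v u z y + ε / 16 := fun v u z hz y hy =>
      amSeq_accuracy hm hn hD hε hL hL36 (Nat.le_ceil _) v u hz hy
    have h := deSeq_regret hm hn q (P := params m C ε) hD.le rfl rfl hδ N hz hy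
    have h1 : ∀ w : Primal m n × Dual m n,
        gradPair (params m C ε).d (params m C ε).D q w w.1 w.2 -
          gradPair (params m C ε).d (params m C ε).D q w z y =
        saddleF C q w.1 y - saddleF C q z w.2 := fun w => gradPair_sub C q w z y
    simp only [h1] at h
    rw [Finset.sum_sub_distrib] at h
    rw [saddleF_smul_sum_fst C q hN0, saddleF_smul_sum_snd C q hN0, ← mul_sub, one_div,
      inv_mul_le_iff₀ hNr]
    refine h.trans ?_
    -- The inner error uses `6/16 = 3/8` of the budget `Nε`. The remaining `5/8` of `480 D log n +
    -- 72 D` is `300 D log n + 45 D`, enough for `300 D log n + 36 D`. The accuracy `ε/16` thus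
    -- makes up for `Θ` having `40 log n` where the range of `r` has `50 log n`.
    change 6 * (50 * costNorm C * Real.log n + 6 * costNorm C + N * (ε / 16)) ≤ _
    rw [div_le_iff₀ hε, Theta] at hN
    nlinarith

/-! ### Operation counts -/

theorem bind_cost_le {α β : Type} {t : Timed α} {f : α → Timed β} {a b : ℕ}
    (ht : t.cost ≤ a) (hf : (f t.val).cost ≤ b) : (t >>= f).cost ≤ a + b :=
  add_le_add ht hf

theorem vec_cost_le {ι : Type} [Fintype ι] {α : Type} {f : ι → Timed α} {c k : ℕ}
    (hk : Fintype.card ι = k) (h : ∀ i, (f i).cost ≤ c) : (vec f).cost ≤ k * (c + 1) := by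
  change ∑ i, ((f i).cost + 1) ≤ _
  refine (Finset.sum_le_sum fun i _ => Nat.add_le_add_right (h i) 1).trans ?_
  rw [Finset.sum_const, Finset.card_univ, hk, smul_eq_mul]

theorem iter_cost_le {α : Type} {f : α → Timed α} {c : ℕ} (h : ∀ a, (f a).cost ≤ c) (N : ℕ)
    (a : α) : (iter f N a).cost ≤ N * (c + 1) := by
  induction N with
  | zero => simp [iter]
  | succ k ih =>
    change (iter f k a).cost + (f (iter f k a).val).cost + 1 ≤ _
    have := h (iter f k a).val
    linarith

theorem card_pair (n : ℕ) : Fintype.card (Fin n × Fin n) = n * n := by simp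

theorem card_double (n : ℕ) : Fintype.card (Fin n ⊕ Fin n) = n + n := by simp

theorem mulA_cost_le {n : ℕ} (x : Fin n × Fin n → ℝ) :
    (mulA x).cost ≤ (n + n) * (2 * n + 1) := by
  refine vec_cost_le (card_double n) fun j => ?_
  rcases j with a | b <;> simp [total]

theorem mulAT_cost_le {n : ℕ} (y : Fin n ⊕ Fin n → ℝ) : (mulAT y).cost ≤ n * n * (3 + 1) :=
  vec_cost_le (card_pair n) fun _ => le_refl 3

theorem softmin_cost_le {ι : Type} [Fintype ι] {k : ℕ} (hk : Fintype.card ι = k) (g : ι → ℝ) :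
    (softmin g).cost ≤ 10 * k := by
  have h : (softmin g).cost ≤ k * (3 + 1) + (2 * k + k * (3 + 1)) :=
    bind_cost_le (vec_cost_le hk fun _ => le_refl 3)
      (bind_cost_le (by simp [total, hk]) (vec_cost_le hk fun _ => le_refl 3))
  linarith

section Size

variable {m n : ℕ}

/-- The monomials that are dominated by `m n²`. -/
theorem monomials_le (hm : 0 < m) (hn : 0 < n) : 1 ≤ m * n ^ 2 ∧ n ≤ m * n ^ 2 ∧
    m ≤ m * n ^ 2 ∧ m * n ≤ m * n ^ 2 ∧ n ^ 2 ≤ m * n ^ 2 := by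
  have h1 : n ≤ n ^ 2 := Nat.le_self_pow two_ne_zero n
  have h2 : n ^ 2 ≤ m * n ^ 2 := Nat.le_mul_of_pos_left _ hm
  have h3 : m * n ≤ m * n ^ 2 := Nat.mul_le_mul_left m h1
  have h4 : m ≤ m * n := Nat.le_mul_of_pos_right _ hn
  exact ⟨by omega, by omega, by omega, h3, h2⟩

/-- Here and below the cost bound mirrors the program's binds; each `le_refl` numeral counts the
operations in one scalar expression by unfolding, and every monomial is absorbed into `m n²`. -/
theorem gradX_cost_le (hm : 0 < m) (hn : 0 < n) (d : Fin n × Fin n → ℝ) (D : ℝ)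
    (y : Dual m n) : (gradX d D y).cost ≤ 22 * (m * n ^ 2) := by
  have h : (gradX d D y).cost ≤
      m * (n * n * (3 + 1) + n * n * (7 + 1) + 1) + (n * (2 * m + 6 + 1) + 0) :=
    bind_cost_le (vec_cost_le (Fintype.card_fin m) fun i =>
        bind_cost_le (mulAT_cost_le _) (vec_cost_le (card_pair n) fun _ => le_refl 7))
      (bind_cost_le (vec_cost_le (Fintype.card_fin n) fun a =>
        bind_cost_le (by simp [total]) (le_refl 6)) le_rfl)
  obtain ⟨h1, h2, h3, h4, h5⟩ := monomials_le hm hn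
  linarith

theorem gradY_cost_le (hm : 0 < m) (hn : 0 < n) (q : Fin m → Fin n → ℝ) (z : Primal m n) :
    (gradY q z).cost ≤ 19 * (m * n ^ 2) := by
  have h : (gradY q z).cost ≤ m * ((n + n) * (2 * n + 1) + (n + n) * (5 + 1) + 1) :=
    vec_cost_le (Fintype.card_fin m) fun i =>
      bind_cost_le (mulA_cost_le _) (vec_cost_le (card_double n) fun j => by
        rcases j with a | b
        · exact le_refl 5
        · exact (le_refl 3).trans (by norm_num))
  obtain ⟨h1, h2, h3, h4, h5⟩ := monomials_le hm hn
  linarith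

theorem axpyP_cost_le (hm : 0 < m) (hn : 0 < n) (c : ℝ) (w v : Primal m n) :
    (axpyP c w v).cost ≤ 13 * (m * n ^ 2) := by
  have h : (axpyP c w v).cost ≤ m * (n * n * (5 + 1) + 1) + (n * (5 + 1) + 0) :=
    bind_cost_le (vec_cost_le (Fintype.card_fin m) fun i =>
        vec_cost_le (card_pair n) fun _ => le_refl 5)
      (bind_cost_le (vec_cost_le (Fintype.card_fin n) fun a => le_refl 5) le_rfl)
  obtain ⟨h1, h2, h3, h4, h5⟩ := monomials_le hm hn
  linarith

theorem axpyD_cost_le (hm : 0 < m) (hn : 0 < n) (c : ℝ) (w v : Dual m n) :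
    (axpyD c w v).cost ≤ 13 * (m * n ^ 2) := by
  have h : (axpyD c w v).cost ≤ m * ((n + n) * (5 + 1) + 1) :=
    vec_cost_le (Fintype.card_fin m) fun i =>
        vec_cost_le (card_double n) fun _ => le_refl 5
  obtain ⟨h1, h2, h3, h4, h5⟩ := monomials_le hm hn
  linarith

theorem amStep_cost_le (hm : 0 < m) (hn : 0 < n) (D : ℝ) (v : Primal m n) (u : Dual m n)
    (z : Primal m n × Dual m n) : (amStep D v u z).cost ≤ 110 * (m * n ^ 2) := by
  have h : (amStep D v u z).cost ≤
      m * ((n + n) * (3 + 1) + (n * n * (3 + 1) + (n * n * (13 + 1) + 10 * (n * n))) + 1) +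
      (n * (m * (3 + 1) + (2 * m + 15) + 1) + (10 * n +
        (m * ((n + n) * (2 * n + 1) + (n + n) * (14 + 1) + 1) + 0))) :=
    bind_cost_le (vec_cost_le (Fintype.card_fin m) fun i =>
        bind_cost_le (vec_cost_le (card_double n) fun _ => le_refl 3)
          (bind_cost_le (mulAT_cost_le _)
            (bind_cost_le (vec_cost_le (card_pair n) fun _ => le_refl 13)
              (softmin_cost_le (card_pair n) _))))
      (bind_cost_le (vec_cost_le (Fintype.card_fin n) fun a =>
          bind_cost_le (vec_cost_le (Fintype.card_fin m) fun _ => le_refl 3)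
            (bind_cost_le (by simp [total]) (le_refl 15)))
        (bind_cost_le (softmin_cost_le (Fintype.card_fin n) _)
          (bind_cost_le (vec_cost_le (Fintype.card_fin m) fun i =>
            bind_cost_le (mulA_cost_le _) (vec_cost_le (card_double n) fun j => by
              rcases j with a | b
              · exact le_refl 14
              · exact (le_refl 12).trans (by norm_num))) le_rfl)))
  obtain ⟨h1, h2, h3, h4, h5⟩ := monomials_le hm hn
  linarith

theorem altMin_cost_le (hm : 0 < m) (hn : 0 < n) (D : ℝ) (M : ℕ) (v : Primal m n)
    (u : Dual m n) : (altMin D M v u).cost ≤ 120 * ((M + 1) * (m * n ^ 2)) := by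
  have h : (altMin D M v u).cost ≤ m * (n * n * (5 + 1) + 1) + (n * (3 + 1) +
      (m * ((n + n) * (1 + 1) + 1) + M * (110 * (m * n ^ 2) + 1))) :=
    bind_cost_le (vec_cost_le (Fintype.card_fin m) fun _ =>
        vec_cost_le (card_pair n) fun _ => le_refl 5)
      (bind_cost_le (vec_cost_le (Fintype.card_fin n) fun _ => le_refl 3)
        (bind_cost_le (vec_cost_le (Fintype.card_fin m) fun _ =>
          vec_cost_le (card_double n) fun _ => le_refl 1)
          (iter_cost_le (fun _ => amStep_cost_le hm hn _ _ _ _) _ _)))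
  obtain ⟨h1, h2, h3, h4, h5⟩ := monomials_le hm hn
  have h6 : M * 1 ≤ M * (m * n ^ 2) := Nat.mul_le_mul_left M h1
  linarith

theorem initParams_cost_le (hm : 0 < m) (hn : 0 < n) (C : Matrix (Fin n) (Fin n) ℝ) (ε : ℝ) :
    (initParams m C ε).cost ≤ 72 * (m * n ^ 2) + (params m C ε).M := by
  have h : (initParams m C ε).cost ≤ n * n * (1 + 1) + (3 * (n * n) + (10 +
      ((22 + (params m C ε).M + 1) + (m * (n * n * (13 + 1) + 1) + (n * (13 + 1) +
        (m * ((n + n) * (1 + 1) + 1) + 0)))))) :=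
    bind_cost_le (vec_cost_le (card_pair n) fun _ => le_refl 1)
      (bind_cost_le (by simp [maxAbs])
        (bind_cost_le (le_refl 10)
          (bind_cost_le (le_refl (22 + (params m C ε).M + 1))
            (bind_cost_le (vec_cost_le (Fintype.card_fin m) fun _ =>
                vec_cost_le (card_pair n) fun _ => le_refl 13)
              (bind_cost_le (vec_cost_le (Fintype.card_fin n) fun _ => le_refl 13)
                (bind_cost_le (vec_cost_le (Fintype.card_fin m) fun _ =>
                  vec_cost_le (card_double n) fun _ => le_refl 1) le_rfl))))))
  obtain ⟨h1, h2, h3, h4, h5⟩ := monomials_le hm hn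
  linarith

theorem deStep_cost_le (hm : 0 < m) (hn : 0 < n) (q : Fin m → Fin n → ℝ) (P : Params m n)
    (S : State m n) : (deStep q P S).cost ≤ 490 * ((P.M + 1) * (m * n ^ 2)) := by
  have hP := axpyP_cost_le hm hn
  have hQ := axpyD_cost_le hm hn
  have hA := altMin_cost_le hm hn
  have hX := gradX_cost_le hm hn
  have hY := gradY_cost_le hm hn
  have h : (deStep q P S).cost ≤ 13 * (m * n ^ 2) + (13 * (m * n ^ 2) +
      (120 * ((P.M + 1) * (m * n ^ 2)) + (5 + (22 * (m * n ^ 2) + (13 * (m * n ^ 2) +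
      (7 + (19 * (m * n ^ 2) + (13 * (m * n ^ 2) + (120 * ((P.M + 1) * (m * n ^ 2)) +
      (7 + (22 * (m * n ^ 2) + (13 * (m * n ^ 2) + (5 + (19 * (m * n ^ 2) +
      (13 * (m * n ^ 2) + (13 * (m * n ^ 2) + (13 * (m * n ^ 2) + 0))))))))))))))))) :=
    bind_cost_le (hP _ _ _) <| bind_cost_le (hQ _ _ _) <| bind_cost_le (hA _ _ _ _) <|
    bind_cost_le (le_refl 5) <| bind_cost_le (hX _ _ _) <| bind_cost_le (hP _ _ _) <|
    bind_cost_le (le_refl 7) <| bind_cost_le (hY _ _) <| bind_cost_le (hQ _ _ _) <|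
    bind_cost_le (hA _ _ _ _) <| bind_cost_le (le_refl 7) <| bind_cost_le (hX _ _ _) <|
    bind_cost_le (hP _ _ _) <| bind_cost_le (le_refl 5) <| bind_cost_le (hY _ _) <|
    bind_cost_le (hQ _ _ _) <| bind_cost_le (hP _ _ _) <| bind_cost_le (hQ _ _ _) le_rfl
  obtain ⟨h1, -⟩ := monomials_le hm hn
  have h6 : 1 * (m * n ^ 2) ≤ (P.M + 1) * (m * n ^ 2) := Nat.mul_le_mul_right _ (by omega)
  linarith

theorem dualExtrapolation_cost_le (hm : 0 < m) (hn : 0 < n) (C : Matrix (Fin n) (Fin n) ℝ)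
    (q : Fin m → Fin n → ℝ) (ε : ℝ) (N : ℕ) :
    (dualExtrapolation C q ε N).cost ≤
      (491 * N + 120) * (((params m C ε).M + 1) * (m * n ^ 2)) := by
  have h : (dualExtrapolation C q ε N).cost ≤ 72 * (m * n ^ 2) + (params m C ε).M +
      (m * (n * n * (1 + 1) + 1) + (n * (1 + 1) + (m * ((n + n) * (1 + 1) + 1) +
      (N * (490 * (((params m C ε).M + 1) * (m * n ^ 2)) + 1) + (3 + (13 * (m * n ^ 2) +
      (13 * (m * n ^ 2) + 0))))))) :=
    bind_cost_le (initParams_cost_le hm hn C ε) <|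
    bind_cost_le (vec_cost_le (Fintype.card_fin m) fun _ =>
      vec_cost_le (card_pair n) fun _ => le_refl 1) <|
    bind_cost_le (vec_cost_le (Fintype.card_fin n) fun _ => le_refl 1) <|
    bind_cost_le (vec_cost_le (Fintype.card_fin m) fun _ =>
      vec_cost_le (card_double n) fun _ => le_refl 1) <|
    bind_cost_le (iter_cost_le (fun S => deStep_cost_le hm hn q (params m C ε) S) _ _) <|
    bind_cost_le (le_refl 3) <| bind_cost_le (axpyP_cost_le hm hn _ _ _) <|
    bind_cost_le (axpyD_cost_le hm hn _ _ _) le_rfl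
  obtain ⟨h1, h2, h3, h4, h5⟩ := monomials_le hm hn
  set M := (params m C ε).M
  have h6 : M * 1 ≤ M * (m * n ^ 2) := Nat.mul_le_mul_left M h1
  have h7 : N * 1 ≤ N * ((M + 1) * (m * n ^ 2)) :=
    Nat.mul_le_mul_left N (by linarith)
  linarith

end Size

/-! ### Iteration counts in terms of `Γ`, and the total running time -/

/-- Both `D/ε` and `Θ/ε` are `O(Γ)`, so the argument is at most quadratic in `Γ ≥ 1`; the constant
is below `2¹²`, and `12 log 2 < 9`. -/
theorem log_accuracyArg_le {n : ℕ} {C : Matrix (Fin n) (Fin n) ℝ} (hD : 0 < costNorm C) {ε : ℝ}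
    (hε : 0 < ε) {Γ : ℝ} (hΓ : Γ = costNorm C / ε * (1 + Real.log n)) (h1 : 1 ≤ Γ) :
    Real.log (accuracyArg C ε) ≤ 9 + 2 * Real.log Γ := by
  have hl := Real.log_natCast_nonneg n
  have hΘ := Theta_pos hD
  set x := costNorm C / ε with hx
  have hx0 : 0 < x := div_pos hD hε
  have hxΓ : x ≤ Γ := by rw [hΓ]; nlinarith
  have hpos : 0 < accuracyArg C ε := by unfold accuracyArg; positivity
  have e : accuracyArg C ε = (88 * x + 4) * ((40 * Real.log n + 6) * x) + 36 * x := by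
    rw [accuracyArg, Theta, hx]; field_simp
  have h2 : (40 * Real.log n + 6) * x ≤ 40 * Γ := by rw [hΓ]; nlinarith
  have h3 : accuracyArg C ε ≤ 2 ^ 12 * Γ ^ 2 := by
    calc accuracyArg C ε ≤ (88 * Γ + 4) * (40 * Γ) + 36 * Γ := by
          rw [e]; gcongr
      _ ≤ 2 ^ 12 * Γ ^ 2 := by nlinarith
  calc Real.log (accuracyArg C ε) ≤ Real.log (2 ^ 12 * Γ ^ 2) := Real.log_le_log hpos h3
    _ = 12 * Real.log 2 + 2 * Real.log Γ := by
      rw [Real.log_mul (by positivity) (by positivity), Real.log_pow, Real.log_pow]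
      norm_num
    _ ≤ 9 + 2 * Real.log Γ := by linarith [Real.log_two_lt_d9]

theorem dualExtrapolation_runtime {m n : ℕ} (hm : 0 < m) (hn : 0 < n)
    {C : Matrix (Fin n) (Fin n) ℝ} (hD : 0 < costNorm C) (q : Fin m → Fin n → ℝ) {ε : ℝ}
    (hε : 0 < ε) {N : ℕ} (hN : N = ⌈12 * Theta C / ε⌉₊) {Γ : ℝ}
    (hΓ : Γ = costNorm C / ε * (1 + Real.log n)) (h1 : 1 ≤ Γ) :
    ((dualExtrapolation C q ε N).cost : ℝ) ≤
      10 ^ 8 * (m * n ^ 2 * (costNorm C / ε)) * ((1 + Real.log n) * (1 + Real.log Γ)) := by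
  have hΘ := Theta_pos hD
  have hl := Real.log_natCast_nonneg n
  have hlΓ := Real.log_nonneg h1
  have hx0 : 0 < costNorm C / ε := div_pos hD hε
  have hNle : (N : ℝ) ≤ 481 * Γ := by
    have h2 : (N : ℝ) < 12 * Theta C / ε + 1 := by
      rw [hN]; exact Nat.ceil_lt_add_one (by positivity)
    have h3 : 12 * Theta C / ε = (480 * Real.log n + 72) * (costNorm C / ε) := by
      rw [Theta]; ring
    have h4 : 12 * Theta C / ε ≤ 480 * Γ := by rw [h3, hΓ]; nlinarith
    linarith
  -- `218 = 24 · 9 + 2`: one unit for rounding up and one for the added `1`.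
  have hMle : ((params m C ε).M : ℝ) + 1 ≤ 218 * (1 + Real.log Γ) := by
    have h2 := log_accuracyArg_le hD hε hΓ h1
    have h3 : ((params m C ε).M : ℝ) < 24 * (9 + 2 * Real.log Γ) + 1 :=
      lt_of_le_of_lt (Nat.cast_le.2 (Nat.ceil_mono (by linarith)))
        (Nat.ceil_lt_add_one (by linarith))
    linarith
  have hcost : ((dualExtrapolation C q ε N).cost : ℝ) ≤
      (491 * N + 120) * (((params m C ε).M + 1) * (m * n ^ 2)) := by
    exact_mod_cast dualExtrapolation_cost_le hm hn C q ε N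
  calc ((dualExtrapolation C q ε N).cost : ℝ)
      ≤ (491 * N + 120) * (((params m C ε).M + 1) * (m * n ^ 2)) := hcost
    _ ≤ (300000 * Γ) * (218 * (1 + Real.log Γ) * (m * n ^ 2)) := by
        gcongr
        linarith
    _ ≤ (10 ^ 8 * Γ) * ((1 + Real.log Γ) * (m * n ^ 2)) := by
        have : 0 ≤ Γ * ((1 + Real.log Γ) * (m * n ^ 2)) := by positivity
        linarith
    _ = 10 ^ 8 * (m * n ^ 2 * (costNorm C / ε)) * ((1 + Real.log n) * (1 + Real.log Γ)) := by
        rw [hΓ]; ring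

end

end WB

theorem mainTheorem1 :
    ∃ K : ℝ, 0 < K ∧
      ∀ (m n : ℕ) (C : Matrix (Fin n) (Fin n) ℝ) (q : Fin m → Fin n → ℝ) (ε : ℝ),
        0 < m → (∀ a b, 0 ≤ C a b) → C ≠ 0 →
        (∀ i, q i ∈ stdSimplex ℝ (Fin n)) → 0 < ε →
        ∀ N : ℕ, N = ⌈12 * WB.Theta C / ε⌉₊ →
          12 * WB.Theta C / ε =
              (480 * Real.log n * WB.costNorm C + 72 * WB.costNorm C) / ε ∧
          (WB.dualExtrapolation C q ε N).val.1 ∈ WB.primalSet m n ∧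
          (WB.dualExtrapolation C q ε N).val.2 ∈ WB.dualSet m n ∧
          WB.DualityGapLE C q (WB.dualExtrapolation C q ε N).val.1
            (WB.dualExtrapolation C q ε N).val.2 ε ∧
          ∀ Γ : ℝ, Γ = WB.costNorm C / ε * (1 + Real.log n) → 1 ≤ Γ →
            ((WB.dualExtrapolation C q ε N).cost : ℝ) ≤
              K * (m * n ^ 2 * (WB.costNorm C / ε)) * ((1 + Real.log n) * (1 + Real.log Γ)) := by
  refine ⟨10 ^ 8, by norm_num, fun m n C q ε hm hC hC0 hq hε N hN => ?_⟩
  -- A nonzero matrix cannot have an empty index set.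
  have hn : 0 < n := by
    rcases Nat.eq_zero_or_pos n with rfl | h
    · exact absurd (Subsingleton.elim C 0) hC0
    · exact h
  have hD : 0 < WB.costNorm C := by
    refine norm_pos_iff.2 fun h => hC0 ?_
    ext a b
    exact congrFun h (a, b)
  obtain ⟨h1, h2, h3⟩ := WB.dualExtrapolation_gap hm hn hC hD hq hε (N := N)
    (hN ▸ Nat.le_ceil _)
  refine ⟨by rw [WB.Theta]; ring, h1, h2, h3, fun Γ hΓ hΓ1 => ?_⟩
  exact WB.dualExtrapolation_runtime hm hn hD q hε hN hΓ hΓ1
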